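/- **Proposition 3.4.** Let $K$ be an algebraically closed field, let $Q_A$, $Q_B$ be finite quivers, and let $I_A\subseteq KQ_A$, $I_B\subseteq KQ_B$ be admissible ideals, i.e. two-sided ideals with $R^m\subseteq I\subseteq R^2$ for some $m\ge 2$, where $R$ is the ideal generated by the arrows of the respective quiver. Put $A=KQ_A/I_A$ and $B=KQ_B/I_B$. Let $a$ be a vertex of $Q_A$ and $b$ a vertex of $Q_B$, let $Q$ be the quiver obtained from the disjoint union of $Q_A$ and $Q_B$ by identifying $a$ with $b$, and let $I$ be the two-sided ideal of $KQ$ generated by the images of $I_A$ and $I_B$. Assume that $\Lambda=KQ/I$ is finite-dimensional over $K$; then $\Lambda$ is called the simple gluing algebra of $A$ and $B$. A finite-dimensional algebra $R$ is called Gorenstein if the left module ${}_RR$ and the right module $R_R$ both have finite injective dimension; these two dimensions are then equal, and $\operatorname{Gd}R$ denotes their common value. Then $\Lambda$ is Gorenstein if and only if both $A$ and $B$ are Gorenstein. Moreover, in this case, $$\max\{\operatorname{Gd}A,\operatorname{Gd}B\}\ \le\ \operatorname{Gd}\Lambda\ \le\ \max\{\operatorname{Gd}A,\operatorname{Gd}B,1\}.$$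 -/

import Mathlib

open CategoryTheory

namespace SimpleGluing

universe u v w u' v'

noncomputable section

/-! ### Path algebras and bound quivers -/

/-- The type of all paths of a quiver, trivial paths included: a source, a target and a path. -/
abbrev AnyPath (V : Type u) [Quiver.{v} V] : Type (max u v) :=
  Σ i : V, Σ j : V, Quiver.Path i j

/-- The path algebra `KQ`: the `K`-vector space whose basis is the set of all paths. -/
def PathAlgebra (K : Type w) [Field K] (V : Type u) [Quiver.{v} V] : Type (max u v w) :=
  AnyPath V →₀ K

namespace PathAlgebra

variable {K : Type w} [Field K] {V : Type u} [Quiver.{v} V]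

instance : AddCommGroup (PathAlgebra K V) := inferInstanceAs (AddCommGroup (AnyPath V →₀ K))

instance : Module K (PathAlgebra K V) := inferInstanceAs (Module K (AnyPath V →₀ K))

variable (K) in
/-- The basis element of the path algebra given by a path. -/
def ofPath {i j : V} (p : Quiver.Path i j) : PathAlgebra K V :=
  Finsupp.single (⟨i, j, p⟩ : AnyPath V) (1 : K)

variable (K) in
/-- The idempotent `e_i`, that is the trivial path at the vertex `i`. -/
def vertexIdem (i : V) : PathAlgebra K V := ofPath K (Quiver.Path.nil : Quiver.Path i i)

open Classical in
variable (K) in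
/-- The product `p q` of two paths: it is "first `q`, then `p`" if `q` ends where `p` starts, and
`0` otherwise. With this convention left modules are (covariant) representations. -/
def pathMul (p q : AnyPath V) : PathAlgebra K V :=
  if h : q.2.1 = p.1 then ofPath K ((q.2.2.cast rfl h).comp p.2.2) else 0

variable (K V) in
/-- The multiplication, extended bilinearly from paths. -/
def mulHom : PathAlgebra K V →ₗ[K] PathAlgebra K V →ₗ[K] PathAlgebra K V :=
  Finsupp.linearCombination K fun p : AnyPath V =>
    (Finsupp.linearCombination K fun q : AnyPath V => pathMul K p q :
      PathAlgebra K V →ₗ[K] PathAlgebra K V)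

instance : Mul (PathAlgebra K V) := ⟨fun x y => mulHom K V x y⟩

/-- The identity is the sum of all the trivial paths (the quiver has finitely many vertices
whenever this is used). -/
instance : One (PathAlgebra K V) := ⟨∑ᶠ i : V, vertexIdem K i⟩

theorem mul_def (x y : PathAlgebra K V) : x * y = mulHom K V x y := rfl

theorem ofPath_mul_ofPath {i j k : V} (p : Quiver.Path j k) (q : Quiver.Path i j) :
    ofPath K p * ofPath K q = ofPath K (q.comp p) := by
  have h : ofPath K p * ofPath K q = pathMul K ⟨j, k, p⟩ ⟨i, j, q⟩ := by
    rw [mul_def, mulHom, ofPath, ofPath]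
    erw [Finsupp.linearCombination_single, one_smul, Finsupp.linearCombination_single, one_smul]
  rw [h, pathMul]
  simp

theorem ofPath_mul_ofPath_of_ne {i j j' k : V} (p : Quiver.Path j' k) (q : Quiver.Path i j)
    (hne : j ≠ j') : ofPath K p * ofPath K q = 0 := by
  have h : ofPath K p * ofPath K q = pathMul K ⟨j', k, p⟩ ⟨i, j, q⟩ := by
    rw [mul_def, mulHom, ofPath, ofPath]
    erw [Finsupp.linearCombination_single, one_smul, Finsupp.linearCombination_single, one_smul]
  rw [h, pathMul]
  simp [hne]

theorem induction {P : PathAlgebra K V → Prop} (x : PathAlgebra K V) (zero : P 0)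
    (add : ∀ x y, P x → P y → P (x + y))
    (smul : ∀ (c : K) (i j : V) (p : Quiver.Path i j), P (c • ofPath K p)) : P x := by
  refine Finsupp.induction_linear (motive := P) x zero add ?_
  rintro ⟨i, j, p⟩ c
  have := smul c i j p
  rw [ofPath] at this
  erw [Finsupp.smul_single, smul_eq_mul, mul_one] at this
  exact this

protected theorem add_mul' (x y z : PathAlgebra K V) : (x + y) * z = x * z + y * z := by
  simp only [mul_def, map_add, LinearMap.add_apply]

protected theorem mul_add' (x y z : PathAlgebra K V) : x * (y + z) = x * y + x * z := by
  simp only [mul_def, map_add]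

protected theorem smul_mul' (c : K) (x y : PathAlgebra K V) : (c • x) * y = c • (x * y) := by
  simp only [mul_def, map_smul, LinearMap.smul_apply]

protected theorem mul_smul' (c : K) (x y : PathAlgebra K V) : x * (c • y) = c • (x * y) := by
  simp only [mul_def, map_smul]

protected theorem zero_mul' (x : PathAlgebra K V) : 0 * x = 0 := by
  simp only [mul_def, map_zero, LinearMap.zero_apply]

protected theorem mul_zero' (x : PathAlgebra K V) : x * 0 = 0 := by
  simp only [mul_def, map_zero]

protected theorem mul_assoc' (x y z : PathAlgebra K V) : x * y * z = x * (y * z) := by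
  induction x using induction with
  | zero => simp only [PathAlgebra.zero_mul']
  | add x x' h h' => simp only [PathAlgebra.add_mul', h, h']
  | smul a i j p =>
  induction y using induction with
  | zero => simp only [PathAlgebra.zero_mul', PathAlgebra.mul_zero']
  | add y y' h h' => simp only [PathAlgebra.add_mul', PathAlgebra.mul_add', h, h']
  | smul b k l q =>
  induction z using induction with
  | zero => simp only [PathAlgebra.mul_zero']
  | add z z' h h' => simp only [PathAlgebra.mul_add', h, h']
  | smul c m n r =>
  simp only [PathAlgebra.smul_mul', PathAlgebra.mul_smul']
  congr 3
  by_cases h₁ : l = i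
  · subst h₁
    by_cases h₂ : n = k
    · subst h₂
      simp only [ofPath_mul_ofPath, Quiver.Path.comp_assoc]
    · rw [ofPath_mul_ofPath, ofPath_mul_ofPath_of_ne _ _ h₂, ofPath_mul_ofPath_of_ne _ _ h₂,
        PathAlgebra.mul_zero']
  · rw [ofPath_mul_ofPath_of_ne _ _ h₁, PathAlgebra.zero_mul']
    by_cases h₂ : n = k
    · subst h₂
      rw [ofPath_mul_ofPath, ofPath_mul_ofPath_of_ne _ _ h₁]
    · rw [ofPath_mul_ofPath_of_ne _ _ h₂, PathAlgebra.mul_zero']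

variable [Finite V]

protected theorem one_mul' (x : PathAlgebra K V) : 1 * x = x := by
  classical
  have := Fintype.ofFinite V
  have h1 : (1 : PathAlgebra K V) = ∑ i : V, vertexIdem K i := finsum_eq_sum_of_fintype _
  induction x using induction with
  | zero => exact PathAlgebra.mul_zero' _
  | add x y h h' => rw [PathAlgebra.mul_add', h, h']
  | smul c i j p =>
    rw [PathAlgebra.mul_smul']
    congr 1
    rw [h1, mul_def, map_sum, LinearMap.sum_apply, Finset.sum_eq_single j]
    · exact (ofPath_mul_ofPath _ _).trans (by rw [Quiver.Path.comp_nil])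
    · exact fun k _ hk => ofPath_mul_ofPath_of_ne _ _ hk.symm
    · simp

protected theorem mul_one' (x : PathAlgebra K V) : x * 1 = x := by
  classical
  have := Fintype.ofFinite V
  have h1 : (1 : PathAlgebra K V) = ∑ i : V, vertexIdem K i := finsum_eq_sum_of_fintype _
  induction x using induction with
  | zero => exact PathAlgebra.zero_mul' _
  | add x y h h' => rw [PathAlgebra.add_mul', h, h']
  | smul c i j p =>
    rw [PathAlgebra.smul_mul']
    congr 1
    rw [h1, mul_def, map_sum, Finset.sum_eq_single i]
    · exact (ofPath_mul_ofPath _ _).trans (by rw [Quiver.Path.nil_comp])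
    · exact fun k _ hk => ofPath_mul_ofPath_of_ne _ _ hk
    · simp

instance : Ring (PathAlgebra K V) where
  __ := (inferInstance : AddCommGroup (PathAlgebra K V))
  __ := (inferInstance : Mul (PathAlgebra K V))
  __ := (inferInstance : One (PathAlgebra K V))
  left_distrib := PathAlgebra.mul_add'
  right_distrib := PathAlgebra.add_mul'
  zero_mul := PathAlgebra.zero_mul'
  mul_zero := PathAlgebra.mul_zero'
  mul_assoc := PathAlgebra.mul_assoc'
  one_mul := PathAlgebra.one_mul'
  mul_one := PathAlgebra.mul_one'

instance : Algebra K (PathAlgebra K V) :=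
  Algebra.ofModule PathAlgebra.smul_mul' PathAlgebra.mul_smul'

variable (K V) in
/-- The arrow ideal `R_Q` of the path algebra: the two-sided ideal generated by all arrows. -/
def arrowIdeal : TwoSidedIdeal (PathAlgebra K V) :=
  TwoSidedIdeal.span {x | ∃ (i j : V) (α : i ⟶ j), x = ofPath K α.toPath}

end PathAlgebra

/-- A two-sided ideal `I` of `KQ` is admissible if `R_Q ^ m ⊆ I ⊆ R_Q ^ 2` for some `m ≥ 2`. -/
def IsAdmissible {K : Type w} [Field K] {V : Type u} [Quiver.{v} V] [Finite V]
    (I : TwoSidedIdeal (PathAlgebra K V)) : Prop :=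
  ∃ m : ℕ, 2 ≤ m ∧ (PathAlgebra.arrowIdeal K V).asIdeal ^ m ≤ I.asIdeal ∧
    I.asIdeal ≤ (PathAlgebra.arrowIdeal K V).asIdeal ^ 2

/-- The quotient algebra `KQ/I`. -/
abbrev QuiverAlgebra {K : Type w} [Field K] {V : Type u} [Quiver.{v} V] [Finite V]
    (I : TwoSidedIdeal (PathAlgebra K V)) : Type (max u v w) :=
  PathAlgebra K V ⧸ I.asIdeal

/-! ### Gluing two quivers at a vertex -/

/-- The relation on the disjoint union of two vertex sets which identifies `a` with `b`. -/
inductive GlueRel {V : Type u} {W : Type u'} (a : V) (b : W) : V ⊕ W → V ⊕ W → Prop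
  | glue : GlueRel a b (Sum.inl a) (Sum.inr b)

/-- The vertices of the simple gluing quiver: the disjoint union with `a` and `b` identified. -/
def GlueVertex {V : Type u} {W : Type u'} (a : V) (b : W) : Type (max u u') :=
  Quot (GlueRel a b)

namespace GlueVertex

variable {V : Type u} {W : Type u'} (a : V) (b : W)

/-- The vertex of the simple gluing quiver given by a vertex of the first quiver. -/
def inl (i : V) : GlueVertex a b := Quot.mk _ (Sum.inl i)

/-- The vertex of the simple gluing quiver given by a vertex of the second quiver. -/
def inr (j : W) : GlueVertex a b := Quot.mk _ (Sum.inr j)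

instance [Finite V] [Finite W] : Finite (GlueVertex a b) :=
  inferInstanceAs (Finite (Quot (GlueRel a b)))

end GlueVertex

/-- The arrows of the simple gluing quiver: the arrows of the first quiver and the arrows of the
second quiver. -/
inductive GlueHom {V : Type u} [Quiver.{v} V] {W : Type u'} [Quiver.{v'} W] (a : V) (b : W) :
    GlueVertex a b → GlueVertex a b → Type (max u v u' v')
  | inl {i j : V} (α : i ⟶ j) : GlueHom a b (GlueVertex.inl a b i) (GlueVertex.inl a b j)
  | inr {i j : W} (β : i ⟶ j) : GlueHom a b (GlueVertex.inr a b i) (GlueVertex.inr a b j)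

section

variable {V : Type u} [Quiver.{v} V] {W : Type u'} [Quiver.{v'} W] (a : V) (b : W)

/-- The simple gluing quiver of two quivers, obtained by identifying the vertices `a` and `b`. -/
instance : Quiver.{max u v u' v'} (GlueVertex a b) := ⟨GlueHom a b⟩

/-- The first quiver as a subquiver of the simple gluing quiver. -/
def glueInl : V ⥤q GlueVertex a b where
  obj := GlueVertex.inl a b
  map := GlueHom.inl

/-- The second quiver as a subquiver of the simple gluing quiver. -/
def glueInr : W ⥤q GlueVertex a b where
  obj := GlueVertex.inr a b
  map := GlueHom.inr

end

/-- The `K`-linear map of path algebras which sends each path to its image under a map of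
quivers. -/
def pathAlgebraMap (K : Type w) [Field K] {V : Type u} [Quiver.{v} V] {W : Type u'}
    [Quiver.{v'} W] (F : V ⥤q W) : PathAlgebra K V →ₗ[K] PathAlgebra K W :=
  Finsupp.linearCombination K fun p : AnyPath V => PathAlgebra.ofPath K (F.mapPath p.2.2)

/-- The two-sided ideal of the path algebra of the simple gluing quiver generated by `I_A` and
`I_B`. -/
def glueIdeal {K : Type w} [Field K] {V : Type u} [Quiver.{v} V] [Finite V]
    {W : Type u'} [Quiver.{v'} W] [Finite W] (a : V) (b : W)
    (I_A : TwoSidedIdeal (PathAlgebra K V)) (I_B : TwoSidedIdeal (PathAlgebra K W)) :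
    TwoSidedIdeal (PathAlgebra K (GlueVertex a b)) :=
  TwoSidedIdeal.span
    (pathAlgebraMap K (glueInl a b) '' (I_A : Set (PathAlgebra K V)) ∪
      pathAlgebraMap K (glueInr a b) '' (I_B : Set (PathAlgebra K W)))

/-! ### Gorenstein algebras -/

/-- The injective dimension of the left regular module. -/
def leftSelfInjDim (R : Type u) [Ring R] : WithBot ℕ∞ :=
  injectiveDimension (ModuleCat.of R R)

/-- The injective dimension of the right regular module, right `R`-modules being left modules
over the opposite ring. -/
def rightSelfInjDim (R : Type u) [Ring R] : WithBot ℕ∞ :=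
  injectiveDimension (ModuleCat.of Rᵐᵒᵖ R)

/-- A finite-dimensional algebra is Gorenstein if it has finite injective dimension as a left and
as a right module over itself. -/
def IsGorenstein (R : Type u) [Ring R] : Prop :=
  leftSelfInjDim R < ⊤ ∧ rightSelfInjDim R < ⊤

/-- The Gorenstein dimension `Gd R` of a Gorenstein algebra, that is the common value of the two
self-injective dimensions; it is written as their maximum, so that the definition favours neither
side and does not presuppose the theorem that they agree. -/
def gorensteinDim (R : Type u) [Ring R] : WithBot ℕ∞ :=
  max (leftSelfInjDim R) (rightSelfInjDim R)

end

end SimpleGluing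

/-!
The proof treats the simple gluing algebra `Λ` through its universal property. Both `A` and `B` map
to `Λ` by homomorphisms which do not preserve the identity; an algebra homomorphism from `Λ` is the
same thing as a pair of such homomorphisms from `A` and `B` which agree on the common vertex and
send the remaining vertices to orthogonal idempotents (`Gluing`). Since the ideals lie in the arrow
ideals, `A` and `B` have augmentations at the common vertex; mapping one algebra identically and the
other one through its augmentation gives retractions `Λ → A` and `Λ → B`.

The one essential construction is `Gluing.exists_twisted_extension`: for `Λ`-modules `M`, `N`, a
derivation `d : A → Hom_K(N, M)` which vanishes at the common vertex makes `M × N` an extension of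
`N` by `M`, on which `A` acts through `d` and `B` acts diagonally. If `M` is injective or `N` is
projective the extension splits, which means that `d` is the inner derivation of a `K`-linear map
commuting with `B`. Three facts follow.

* The restriction `e_A M` (`Corner`) of an injective `Λ`-module is injective over `A`, since every
  `A`-module is restricted from its inflation along `Λ → A` (`Gluing.injective_corner`). Hence
  restriction does not increase injective dimensions. As `A` is a direct summand of `e_A Λ`, this
  gives `id A ≤ id Λ`.
* Dually, `e_A Λ` is a projective `A`-module (`Gluing.exists_corner_section`), finitely generated
  because `Λ` is finite-dimensional. Hence `id (e_A Λ) ≤ id A`.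
* A quotient of an injective `Λ`-module is injective if both of its restrictions are
  (`Gluing.injective_of_injective_corner`). Dimension shifting then gives
  `id M ≤ max (id (e_A M)) (id (e_B M)) 1` for every `Λ`-module `M`, and in particular
  `id Λ ≤ max (id A) (id B) 1`.

The notion of a gluing is stable under passing to opposite algebras, so the same inequalities hold
for right modules, and the theorem is a formal consequence of the two sets of inequalities.
-/

namespace SimpleGluing

universe w uA uB u v u' v' t

/-! ### Corners -/

section Corner

variable {K : Type w} [Field K] {A : Type uA} [Ring A] [Algebra K A] {Λ : Type*} [Ring Λ]
  [Algebra K Λ] (i : A →ₙₐ[K] Λ) (M : Type*) [AddCommGroup M] [Module Λ M]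

/-- The subgroup `i(1) M` of a `Λ`-module `M`, for a homomorphism `i : A → Λ` which need not
preserve the identity. -/
def cornerSubgroup : AddSubgroup M where
  carrier := {m | i 1 • m = m}
  zero_mem' := smul_zero _
  add_mem' {x y} hx hy := by
    rw [Set.mem_ofPred_eq] at *
    rw [smul_add, hx, hy]
  neg_mem' {x} hx := by
    rw [Set.mem_ofPred_eq] at *
    rw [smul_neg, hx]

/-- The restriction `i(1) M` of a `Λ`-module `M` along a non-unital homomorphism `i : A → Λ`, as
an `A`-module. For a subquiver it is the restriction of a representation to that subquiver. -/
def Corner : Type _ := cornerSubgroup i M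

namespace Corner

instance : AddCommGroup (Corner i M) := inferInstanceAs (AddCommGroup (cornerSubgroup i M))

variable {i M}

/-- The inclusion of the corner `i(1) M` into `M`. -/
def val : Corner i M →+ M := (cornerSubgroup i M).subtype

theorem val_injective : Function.Injective (val : Corner i M → M) := Subtype.val_injective

@[simp] theorem one_smul_val (m : Corner i M) : i 1 • val m = val m := m.2

theorem map_mul_one_smul (x : A) (m : M) : i x • i 1 • m = i x • m := by
  rw [smul_smul, ← map_mul, mul_one]

theorem one_smul_map (x : A) (m : M) : i 1 • i x • m = i x • m := by
  rw [smul_smul, ← map_mul, one_mul]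

/-- An element of `M` which is fixed by `i(1)`, as an element of the corner. -/
def mk (m : M) (h : i 1 • m = m) : Corner i M := ⟨m, h⟩

@[simp] theorem val_mk (m : M) (h : i 1 • m = m) : val (mk m h) = m := rfl

instance : Module A (Corner i M) where
  smul x m := mk (i x • val m) (one_smul_map _ _)
  one_smul m := val_injective (one_smul_val m)
  mul_smul x y m := val_injective (by
    change i (x * y) • val m = i x • i y • val m
    rw [map_mul, mul_smul])
  smul_zero x := val_injective (by
    change i x • val (0 : Corner i M) = val (0 : Corner i M)
    rw [map_zero, smul_zero])
  smul_add x m n := val_injective (by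
    change i x • val (m + n) = i x • val m + i x • val n
    rw [map_add, smul_add])
  add_smul x y m := val_injective (by
    change i (x + y) • val m = i x • val m + i y • val m
    rw [map_add, add_smul])
  zero_smul m := val_injective (by
    change i 0 • val m = val (0 : Corner i M)
    rw [map_zero, map_zero, zero_smul])

@[simp] theorem val_smul (x : A) (m : Corner i M) : val (x • m) = i x • val m := rfl

section

variable [Module K M] [IsScalarTower K Λ M]

instance : Module K (Corner i M) where
  smul c m := mk (c • val m) (by
    have := IsScalarTower.to_smulCommClass (R := K) (A := Λ) (M := M)
    rw [smul_comm, one_smul_val])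
  one_smul m := val_injective (one_smul K (val m))
  mul_smul c d m := val_injective (mul_smul c d (val m))
  smul_zero c := val_injective (by
    change c • val (0 : Corner i M) = val (0 : Corner i M)
    rw [map_zero, smul_zero])
  smul_add c m n := val_injective (by
    change c • val (m + n) = c • val m + c • val n
    rw [map_add, smul_add])
  add_smul c d m := val_injective (add_smul c d (val m))
  zero_smul m := val_injective (by
    change (0 : K) • val m = val (0 : Corner i M)
    rw [map_zero, zero_smul])

@[simp] theorem val_smul' (c : K) (m : Corner i M) : val (c • m) = c • val m := rfl

instance : IsScalarTower K A (Corner i M) where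
  smul_assoc c x m := val_injective (by simp)

/-- The inclusion of the corner as a `K`-linear map. -/
def valₗ : Corner i M →ₗ[K] M where
  toFun := val
  map_add' := map_add _
  map_smul' _ _ := rfl

@[simp] theorem valₗ_apply (m : Corner i M) : valₗ (K := K) m = val m := rfl

end

variable {N P : Type*} [AddCommGroup N] [Module Λ N] [AddCommGroup P] [Module Λ P]

/-- The element `i(1) m` of the corner. -/
def proj (m : M) : Corner i M := mk (i 1 • m) (one_smul_map _ _)

@[simp] theorem val_proj (m : M) : val (proj m : Corner i M) = i 1 • m := rfl

@[simp] theorem proj_val (m : Corner i M) : proj (val m) = m := val_injective (one_smul_val m)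

theorem proj_map_smul (x : A) (m : M) : (proj (i x • m) : Corner i M) = x • proj m :=
  val_injective (by rw [val_proj, one_smul_map, val_smul, val_proj, map_mul_one_smul])

/-- The projection to the corner as a `K`-linear map. -/
def projₗ [Module K M] [IsScalarTower K Λ M] : M →ₗ[K] Corner i M where
  toFun := proj
  map_add' _ _ := val_injective (by simp)
  map_smul' c m := val_injective (by
    have := IsScalarTower.to_smulCommClass (R := K) (A := Λ) (M := M)
    rw [val_proj, smul_comm, RingHom.id_apply, val_smul', val_proj])

@[simp] theorem projₗ_apply [Module K M] [IsScalarTower K Λ M] (m : M) :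
    (projₗ (K := K) m : Corner i M) = proj m := rfl

variable (i) in
/-- The map between corners induced by a linear map. -/
def map (f : M →ₗ[Λ] N) : Corner i M →ₗ[A] Corner i N where
  toFun m := mk (f (val m)) (by rw [← map_smul, one_smul_val])
  map_add' m n := val_injective (by simp)
  map_smul' x m := val_injective (by simp)

@[simp] theorem val_map (f : M →ₗ[Λ] N) (m : Corner i M) : val (map i f m) = f (val m) := rfl

theorem map_injective {f : M →ₗ[Λ] N} (hf : Function.Injective f) :
    Function.Injective (map i f) := fun x y h =>
  val_injective (hf (by simpa using congrArg val h))

theorem map_surjective {f : M →ₗ[Λ] N} (hf : Function.Surjective f) :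
    Function.Surjective (map i f) := fun y => by
  obtain ⟨x, hx⟩ := hf (val y)
  exact ⟨proj x, val_injective (by simp [hx])⟩

theorem map_exact {f : M →ₗ[Λ] N} {g : N →ₗ[Λ] P} (h : Function.Exact f g) :
    Function.Exact (map i f) (map i g) := fun y => by
  constructor
  · intro hy
    obtain ⟨x, hx⟩ := (h (val y)).1 (by simpa using congrArg val hy)
    exact ⟨proj x, val_injective (by simp [hx])⟩
  · rintro ⟨x, rfl⟩
    exact val_injective (by simpa using (h _).2 ⟨val x, rfl⟩)

end Corner

end Corner

/-! ### Abstract gluings of algebras -/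

/-- A pair of non-unital homomorphisms `f : A → T`, `g : B → T` which looks like the pair of
inclusions into a gluing of `A` and `B` at the idempotents `a` and `b`: the idempotents `f(1)` and
`g(1)` commute, their product is `f(a) = g(b)`, and `f(1) + g(1) - f(a) = 1`. -/
structure GluingPair {K : Type*} [Field K] {A : Type*} [Ring A] [Algebra K A]
    {B : Type*} [Ring B] [Algebra K B] {T : Type*} [Ring T] [Algebra K T]
    (a : A) (b : B) (f : A →ₙₐ[K] T) (g : B →ₙₐ[K] T) : Prop where
  map_eq : f a = g b
  mul_eq : f 1 * g 1 = f a
  mul_eq' : g 1 * f 1 = f a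
  add_eq : f 1 + g 1 = 1 + f a

/-- A presentation of `Λ` as the gluing of the algebras `A` and `B` at the idempotents `a` and
`b`: the universal algebra with a `GluingPair`, which moreover retracts onto `A` and `B`.
Replacing all algebras by their opposites gives a gluing again, and it is only through this
structure that the path algebras enter. The universe of `T` in the universal property is the one of
the `Λ`-modules on which actions are built with it. -/
structure Gluing (K : Type w) (A : Type uA) (B : Type uB) (Λ : Type u) [Field K] [Ring A]
    [Algebra K A] [Ring B] [Algebra K B] [Ring Λ] [Algebra K Λ] where
  /-- the idempotent of the first algebra at which the algebras are glued -/
  a : A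
  /-- the idempotent of the second algebra at which the algebras are glued -/
  b : B
  /-- the inclusion of the first algebra -/
  inA : A →ₙₐ[K] Λ
  /-- the inclusion of the second algebra -/
  inB : B →ₙₐ[K] Λ
  /-- the retraction to the first algebra -/
  retrA : Λ →ₐ[K] A
  /-- the retraction to the second algebra -/
  retrB : Λ →ₐ[K] B
  pair : GluingPair a b inA inB
  retrA_inA : ∀ x, retrA (inA x) = x
  retrB_inB : ∀ y, retrB (inB y) = y
  adjoin_eq_top : Algebra.adjoin K (Set.range inA ∪ Set.range inB) = ⊤
  lift : ∀ (T : Type u) [Ring T] [Algebra K T] (f : A →ₙₐ[K] T) (g : B →ₙₐ[K] T),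
    GluingPair a b f g → ∃ φ : Λ →ₐ[K] T, (∀ x, φ (inA x) = f x) ∧ ∀ y, φ (inB y) = g y

theorem GluingPair.symm {K : Type*} [Field K] {A : Type*} [Ring A] [Algebra K A]
    {B : Type*} [Ring B] [Algebra K B] {T : Type*} [Ring T] [Algebra K T]
    {a : A} {b : B} {f : A →ₙₐ[K] T} {g : B →ₙₐ[K] T} (h : GluingPair a b f g) :
    GluingPair b a g f where
  map_eq := h.map_eq.symm
  mul_eq := h.mul_eq'.trans h.map_eq
  mul_eq' := h.mul_eq.trans h.map_eq
  add_eq := by rw [add_comm, h.add_eq, h.map_eq]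

section LinearExtension

variable (K : Type*) [Field K] {A : Type*} [Ring A] [Algebra K A] {a : A}
  {X Y Q : Type*} [AddCommGroup X] [Module A X] [Module K X] [IsScalarTower K A X]
  [AddCommGroup Y] [Module A Y] [Module K Y] [IsScalarTower K A Y]
  [AddCommGroup Q] [Module A Q] [Module K Q] [IsScalarTower K A Q]

variable {K} in
/-- The diagonal part `a G a + (1 - a) G (1 - a)` of a map `G` commutes with the idempotent `a`. -/
theorem exists_diagonal_part (ha : a * a = a) (G : Y →ₗ[K] Q) : ∃ G' : Y →ₗ[K] Q,
    (∀ y, G' y = a • G (a • y) + (1 - a) • G ((1 - a) • y)) ∧ ∀ y, G' (a • y) = a • G' y := by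
  refine ⟨Algebra.lsmul K K Q a ∘ₗ G ∘ₗ Algebra.lsmul K K Y a +
    Algebra.lsmul K K Q (1 - a) ∘ₗ G ∘ₗ Algebra.lsmul K K Y (1 - a), fun y => rfl, fun y => ?_⟩
  have h : (1 - a) * a = 0 := by rw [sub_mul, one_mul, ha, sub_self]
  have h' : a * (1 - a) = 0 := by rw [mul_sub, mul_one, ha, sub_self]
  simp only [LinearMap.add_apply, LinearMap.comp_apply, Algebra.lsmul_coe, smul_add, smul_smul,
    ha, h, h', zero_smul, map_zero]

theorem smul_add_one_sub_smul (ha : a * a = a) (q : Q) :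
    a • a • q + (1 - a) • (1 - a) • q = q := by
  have h : (1 - a) * (1 - a) = 1 - a := by rw [sub_mul, one_mul, mul_sub, mul_one, ha, sub_self,
    sub_zero]
  rw [smul_smul, smul_smul, ha, h, ← add_smul, add_sub_cancel, one_smul]

/-- A linear map on a submodule extends to a `K`-linear map which commutes with a given
idempotent. -/
theorem exists_linear_extension (ha : a * a = a) (f : X →ₗ[A] Y) (hf : Function.Injective f)
    (g : X →ₗ[A] Q) : ∃ G : Y →ₗ[K] Q, (∀ x, G (f x) = g x) ∧ ∀ y, G (a • y) = a • G y := by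
  obtain ⟨r, hr⟩ := (f.restrictScalars K).exists_leftInverse_of_injective
    (LinearMap.ker_eq_bot.2 hf)
  have hr' : ∀ x, r (f x) = x := fun x => LinearMap.congr_fun hr x
  obtain ⟨G, hG, hG'⟩ := exists_diagonal_part ha (g.restrictScalars K ∘ₗ r)
  refine ⟨G, fun x => ?_, hG'⟩
  rw [hG]
  simp only [← map_smul f, LinearMap.comp_apply, hr', LinearMap.coe_restrictScalars, map_smul g]
  exact smul_add_one_sub_smul ha _

/-- A linear map to a quotient lifts to a `K`-linear map which commutes with a given
idempotent. -/
theorem exists_linear_lift (ha : a * a = a) (q : Y →ₗ[A] Q) (hq : Function.Surjective q)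
    (g : X →ₗ[A] Q) : ∃ G : X →ₗ[K] Y, (∀ x, q (G x) = g x) ∧ ∀ x, G (a • x) = a • G x := by
  obtain ⟨s, hs⟩ := (q.restrictScalars K).exists_rightInverse_of_surjective
    (LinearMap.range_eq_top.2 hq)
  have hs' : ∀ x, q (s x) = x := fun x => LinearMap.congr_fun hs x
  obtain ⟨G, hG, hG'⟩ := exists_diagonal_part ha (s ∘ₗ g.restrictScalars K)
  refine ⟨G, fun x => ?_, hG'⟩
  rw [hG]
  simp only [map_add, map_smul q, LinearMap.comp_apply, hs', LinearMap.coe_restrictScalars,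
    map_smul g]
  exact smul_add_one_sub_smul ha _

end LinearExtension

section Representations

variable {K : Type*} [Field K] {Λ : Type u} [Ring Λ] [Algebra K Λ]
  {M N X : Type u} [AddCommGroup M] [Module K M] [Module Λ M] [IsScalarTower K Λ M]
  [AddCommGroup N] [Module K N] [Module Λ N] [IsScalarTower K Λ N] [AddCommGroup X] [Module K X]

/-- An injective submodule of a representation of `Λ` on a vector space has an equivariant
retraction. -/
theorem exists_retraction_of_injective [Module.Injective Λ M] (φ : Λ →ₐ[K] Module.End K X)
    (i : M →ₗ[K] X) (hi : Function.Injective i) (hφ : ∀ l m, i (l • m) = φ l (i m)) :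
    ∃ r : X →ₗ[K] M, (∀ m, r (i m) = m) ∧ ∀ l x, r (φ l x) = l • r x := by
  let : Module Λ X := Module.compHom X φ.toRingHom
  have hsm : ∀ (l : Λ) (x : X), l • x = φ l x := fun _ _ => rfl
  have : IsScalarTower K Λ X := ⟨fun c l x => by
    rw [hsm, hsm, map_smul, LinearMap.smul_apply]⟩
  obtain ⟨r, hr⟩ := Module.Injective.out (R := Λ)
    { toFun := i, map_add' := map_add i, map_smul' := hφ : M →ₗ[Λ] X } hi LinearMap.id
  exact ⟨r.restrictScalars K, hr, fun l x => map_smul r l x⟩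

/-- A representation of `Λ` on a vector space which surjects to a projective module has an
equivariant section. -/
theorem exists_section_of_projective [Module.Projective Λ N] (φ : Λ →ₐ[K] Module.End K X)
    (p : X →ₗ[K] N) (hp : Function.Surjective p) (hφ : ∀ l x, p (φ l x) = l • p x) :
    ∃ s : N →ₗ[K] X, (∀ n, p (s n) = n) ∧ ∀ l n, s (l • n) = φ l (s n) := by
  let : Module Λ X := Module.compHom X φ.toRingHom
  have hsm : ∀ (l : Λ) (x : X), l • x = φ l x := fun _ _ => rfl
  have : IsScalarTower K Λ X := ⟨fun c l x => by
    rw [hsm, hsm, map_smul, LinearMap.smul_apply]⟩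
  obtain ⟨s, hs⟩ := Module.projective_lifting_property
    { toFun := p, map_add' := map_add p, map_smul' := hφ : X →ₗ[Λ] N } LinearMap.id hp
  exact ⟨s.restrictScalars K, fun n => LinearMap.congr_fun hs n, fun l x => map_smul s l x⟩

end Representations

namespace Gluing

variable {K : Type w} {A : Type uA} {B : Type uB} {Λ : Type u} [Field K] [Ring A]
    [Algebra K A] [Ring B] [Algebra K B] [Ring Λ] [Algebra K Λ] (g : Gluing K A B Λ)

/-- The gluing with the roles of the two algebras exchanged. -/
def symm : Gluing K B A Λ where
  a := g.b
  b := g.a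
  inA := g.inB
  inB := g.inA
  retrA := g.retrB
  retrB := g.retrA
  pair := g.pair.symm
  retrA_inA := g.retrB_inB
  retrB_inB := g.retrA_inA
  adjoin_eq_top := by rw [Set.union_comm, g.adjoin_eq_top]
  lift T _ _ f f' h := by
    obtain ⟨φ, h₁, h₂⟩ := g.lift T f' f h.symm
    exact ⟨φ, h₂, h₁⟩

theorem inA_one_mul (x : A) : g.inA 1 * g.inA x = g.inA x := by rw [← map_mul, one_mul]

theorem inA_mul_one (x : A) : g.inA x * g.inA 1 = g.inA x := by rw [← map_mul, mul_one]

theorem inB_one_mul (y : B) : g.inB 1 * g.inB y = g.inB y := by rw [← map_mul, one_mul]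

theorem inB_mul_one (y : B) : g.inB y * g.inB 1 = g.inB y := by rw [← map_mul, mul_one]

theorem inA_a_mul_self : g.inA g.a * g.inA g.a = g.inA g.a := by
  conv_lhs => rw [← g.pair.mul_eq, mul_assoc, g.pair.mul_eq, g.pair.map_eq, inB_one_mul,
    ← g.pair.map_eq, inA_one_mul]

theorem a_mul_self : g.a * g.a = g.a := by
  have := congrArg g.retrA g.inA_a_mul_self
  rwa [map_mul, g.retrA_inA] at this

variable {M N : Type u} [AddCommGroup M] [Module K M] [Module Λ M] [IsScalarTower K Λ M]
  [AddCommGroup N] [Module K N] [Module Λ N] [IsScalarTower K Λ N]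

/-- A `K`-linear map which commutes with both of the glued algebras is `Λ`-linear. -/
theorem map_smul_of_commute (h : M →ₗ[K] N) (hA : ∀ x m, h (g.inA x • m) = g.inA x • h m)
    (hB : ∀ y m, h (g.inB y • m) = g.inB y • h m) (l : Λ) (m : M) : h (l • m) = l • h m := by
  have hl : l ∈ Algebra.adjoin K (Set.range g.inA ∪ Set.range g.inB) := by
    rw [g.adjoin_eq_top]; trivial
  induction hl using Algebra.adjoin_induction generalizing m with
  | mem x hx =>
    rcases hx with ⟨x, rfl⟩ | ⟨y, rfl⟩
    · exact hA x m
    · exact hB y m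
  | algebraMap c => simp [algebraMap_smul]
  | add x y _ _ hx hy => rw [add_smul, add_smul, map_add, hx, hy]
  | mul x y _ _ hx hy => rw [mul_smul, mul_smul, hx, hy]

/-- The twisted extension of `N` by `M` given by a derivation `d : A → Hom_K(N, M)`: the first
algebra acts on `M × N` through `d`, the second one acts diagonally. -/
theorem exists_twisted_extension (d : A →ₗ[K] N →ₗ[K] M)
    (hd : ∀ x x' n, d (x * x') n = g.inA x • d x' n + d x (g.inA x' • n))
    (hd_a : d g.a = 0) (hd_one : d 1 = 0) : ∃ φ : Λ →ₐ[K] Module.End K (M × N),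
      (∀ x m n, φ (g.inA x) (m, n) = (g.inA x • m + d x n, g.inA x • n)) ∧
      (∀ y m n, φ (g.inB y) (m, n) = (g.inB y • m, g.inB y • n)) := by
  let f : A →ₙₐ[K] Module.End K (M × N) :=
    { toFun := fun x =>
        LinearMap.prod (Algebra.lsmul K K M (g.inA x) ∘ₗ LinearMap.fst K M N +
          d x ∘ₗ LinearMap.snd K M N) (Algebra.lsmul K K N (g.inA x) ∘ₗ LinearMap.snd K M N)
      map_smul' := fun c x => by
        ext p <;> simp
      map_zero' := by ext p <;> simp
      map_add' := fun x y => by ext p <;> simp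
      map_mul' := fun x y => by ext p <;> simp [hd] }
  let f' : B →ₙₐ[K] Module.End K (M × N) :=
    { toFun := fun x =>
        LinearMap.prod (Algebra.lsmul K K M (g.inB x) ∘ₗ LinearMap.fst K M N)
          (Algebra.lsmul K K N (g.inB x) ∘ₗ LinearMap.snd K M N)
      map_smul' := fun c x => by
        ext p <;> simp
      map_zero' := by ext p <;> simp
      map_add' := fun x y => by ext p <;> simp
      map_mul' := fun x y => by ext p <;> simp }
  have hf : ∀ x m n, f x (m, n) = (g.inA x • m + d x n, g.inA x • n) := fun _ _ _ => rfl
  have hf' : ∀ y m n, f' y (m, n) = (g.inB y • m, g.inB y • n) := fun _ _ _ => rfl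
  have key : GluingPair g.a g.b f f' := by
    refine ⟨?_, ?_, ?_, ?_⟩
    · refine LinearMap.ext fun ⟨m, n⟩ => ?_
      rw [hf, hf', hd_a, g.pair.map_eq, LinearMap.zero_apply, add_zero]
    · refine LinearMap.ext fun ⟨m, n⟩ => ?_
      rw [Module.End.mul_apply, hf', hf, hf, hd_a, hd_one, LinearMap.zero_apply,
        LinearMap.zero_apply, add_zero, add_zero, smul_smul, smul_smul, g.pair.mul_eq]
    · refine LinearMap.ext fun ⟨m, n⟩ => ?_
      rw [Module.End.mul_apply, hf, hf', hf, hd_a, hd_one, LinearMap.zero_apply,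
        add_zero, add_zero, smul_smul, smul_smul, g.pair.mul_eq']
    · refine LinearMap.ext fun ⟨m, n⟩ => ?_
      rw [LinearMap.add_apply, LinearMap.add_apply, hf, hf', hf, hd_a, hd_one,
        LinearMap.zero_apply, add_zero, add_zero, Module.End.one_apply,
        Prod.mk_add_mk, ← add_smul, ← add_smul, g.pair.add_eq, Prod.mk_add_mk, add_smul, add_smul,
        one_smul, one_smul]
  obtain ⟨φ, h₁, h₂⟩ := g.lift _ f f' key
  exact ⟨φ, fun x m n => by rw [h₁, hf], fun y m n => by rw [h₂, hf']⟩

/-- If `M` is injective, every derivation `A → Hom_K(N, M)` is inner by a map commuting with the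
second algebra. -/
theorem exists_inner_of_injective [Module.Injective Λ M] (d : A →ₗ[K] N →ₗ[K] M)
    (hd : ∀ x x' n, d (x * x') n = g.inA x • d x' n + d x (g.inA x' • n))
    (hd_a : d g.a = 0) (hd_one : d 1 = 0) : ∃ σ : N →ₗ[K] M,
      (∀ x n, d x n = g.inA x • σ n - σ (g.inA x • n)) ∧
      ∀ y n, σ (g.inB y • n) = g.inB y • σ n := by
  obtain ⟨φ, hA, hB⟩ := g.exists_twisted_extension d hd hd_a hd_one
  have hi : ∀ (l : Λ) (m : M), φ l (m, 0) = (l • m, 0) := by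
    intro l
    have hl : l ∈ Algebra.adjoin K (Set.range g.inA ∪ Set.range g.inB) := by
      rw [g.adjoin_eq_top]; trivial
    induction hl using Algebra.adjoin_induction with
    | mem x hx =>
      rcases hx with ⟨x, rfl⟩ | ⟨y, rfl⟩
      · intro m; rw [hA, map_zero, smul_zero, add_zero]
      · intro m; rw [hB, smul_zero]
    | algebraMap c => intro m; simp [Module.algebraMap_end_apply, algebraMap_smul]
    | add x y _ _ hx hy => intro m; simp [hx, hy, add_smul]
    | mul x y _ _ hx hy => intro m; simp [hx, hy, mul_smul]
  obtain ⟨r, hr, hr'⟩ := exists_retraction_of_injective φ (LinearMap.inl K M N)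
    LinearMap.inl_injective (fun l m => (hi l m).symm)
  refine ⟨r ∘ₗ LinearMap.inr K M N, fun x n => ?_, fun y n => ?_⟩
  · have h := hr' (g.inA x) (0, n)
    rw [hA, smul_zero, zero_add, show ((d x n, g.inA x • n) : M × N) =
      LinearMap.inl K M N (d x n) + LinearMap.inr K M N (g.inA x • n) by simp, map_add, hr] at h
    exact eq_sub_of_add_eq h
  · have h := hr' (g.inB y) (0, n)
    rwa [hB, smul_zero] at h

/-- If `N` is projective, every derivation `A → Hom_K(N, M)` is inner by a map commuting with the
second algebra. -/
theorem exists_inner_of_projective [Module.Projective Λ N] (d : A →ₗ[K] N →ₗ[K] M)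
    (hd : ∀ x x' n, d (x * x') n = g.inA x • d x' n + d x (g.inA x' • n))
    (hd_a : d g.a = 0) (hd_one : d 1 = 0) : ∃ σ : N →ₗ[K] M,
      (∀ x n, d x n = g.inA x • σ n - σ (g.inA x • n)) ∧
      ∀ y n, σ (g.inB y • n) = g.inB y • σ n := by
  obtain ⟨φ, hA, hB⟩ := g.exists_twisted_extension d hd hd_a hd_one
  have hp : ∀ (l : Λ) (x : M × N), (φ l x).2 = l • x.2 := by
    intro l
    have hl : l ∈ Algebra.adjoin K (Set.range g.inA ∪ Set.range g.inB) := by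
      rw [g.adjoin_eq_top]; trivial
    induction hl using Algebra.adjoin_induction with
    | mem x hx =>
      rcases hx with ⟨x, rfl⟩ | ⟨y, rfl⟩
      · rintro ⟨m, n⟩; rw [hA]
      · rintro ⟨m, n⟩; rw [hB]
    | algebraMap c => intro m; simp [Module.algebraMap_end_apply, algebraMap_smul]
    | add x y _ _ hx hy => intro m; simp [hx, hy, add_smul]
    | mul x y _ _ hx hy => intro m; simp [hx, hy, mul_smul]
  obtain ⟨s, hs, hs'⟩ := exists_section_of_projective φ (LinearMap.snd K M N)
    LinearMap.snd_surjective hp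
  have hs2 : ∀ n, s n = ((s n).1, n) := fun n => Prod.ext rfl (hs n)
  refine ⟨-(LinearMap.fst K M N ∘ₗ s), fun x n => ?_, fun y n => ?_⟩
  · have h := congrArg Prod.fst (hs' (g.inA x) n)
    rw [hs2 n, hA] at h
    simp only [LinearMap.neg_apply, LinearMap.comp_apply, LinearMap.fst_apply, h, smul_neg]
    abel
  · have h := congrArg Prod.fst (hs' (g.inB y) n)
    rw [hs2 n, hB] at h
    simp only [LinearMap.neg_apply, LinearMap.comp_apply, LinearMap.fst_apply, h, smul_neg]

end Gluing

/-! ### Derivations and splittings over a single algebra -/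

/-- A module over a `K`-algebra is a vector space over `K`, compatibly with the action. -/
theorem isScalarTower_compHom (K : Type*) [Field K] {R : Type*} [Ring R] [Algebra K R]
    (M : Type*) [AddCommGroup M] [Module R M] :
    letI : Module K M := Module.compHom M (algebraMap K R)
    IsScalarTower K R M := by
  let : Module K M := Module.compHom M (algebraMap K R)
  refine ⟨fun c x m => ?_⟩
  rw [Algebra.smul_def, mul_smul]
  rfl

section Derivation

variable (K : Type*) [Field K] {A : Type*} [Ring A] [Algebra K A] {a : A}
  {X Y Z Q : Type*} [AddCommGroup X] [Module A X] [Module K X] [IsScalarTower K A X]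
  [AddCommGroup Y] [Module A Y] [Module K Y] [IsScalarTower K A Y]
  [AddCommGroup Z] [Module A Z] [Module K Z] [IsScalarTower K A Z]
  [AddCommGroup Q] [Module A Q] [Module K Q] [IsScalarTower K A Q]

/-- A linear map on a submodule extends to the whole module if the derivations with values in the
space of `K`-linear maps on the quotient are inner: a `K`-linear extension `G` fails to be
`A`-linear by such a derivation, and is corrected by a map which makes the derivation inner. -/
theorem exists_extension_of_inner (ha : a * a = a) (f : X →ₗ[A] Y) (hf : Function.Injective f)
    (π : Y →ₗ[A] Z) (hπ : Function.Surjective π) (hfπ : Function.Exact f π) (k : X →ₗ[A] Q)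
    (inner : ∀ d : A →ₗ[K] Z →ₗ[K] Q, (∀ x x' z, d (x * x') z = x • d x' z + d x (x' • z)) →
      d a = 0 → ∃ τ : Z →ₗ[K] Q, ∀ x z, d x z = x • τ z - τ (x • z)) :
    ∃ h : Y →ₗ[A] Q, ∀ x, h (f x) = k x := by
  have := IsScalarTower.to_smulCommClass (R := K) (A := A) (M := Y)
  have := IsScalarTower.to_smulCommClass (R := K) (A := A) (M := Q)
  obtain ⟨G, hG, hGa⟩ := exists_linear_extension K ha f hf k
  obtain ⟨s, hs⟩ := (π.restrictScalars K).exists_rightInverse_of_surjective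
    (LinearMap.range_eq_top.2 hπ)
  have hs' : ∀ z, π (s z) = z := fun z => LinearMap.congr_fun hs z
  have key : ∀ (x : A) y, x • G (s (π y)) - G (x • s (π y)) = x • G y - G (x • y) := by
    intro x y
    obtain ⟨t, ht⟩ := (hfπ (s (π y) - y)).1 (by rw [map_sub, hs', sub_self])
    rw [eq_add_of_sub_eq ht.symm, smul_add, map_add, map_add, hG, ← map_smul f, hG, smul_add,
      map_smul k]
    abel
  let d : A →ₗ[K] Z →ₗ[K] Q :=
    LinearMap.mk₂ K (fun x z => x • G (s z) - G (x • s z))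
      (fun x x' z => by simp only [add_smul, map_add]; abel)
      (fun c x z => by rw [smul_assoc, smul_assoc, map_smul, ← smul_sub])
      (fun x z z' => by simp only [smul_add, map_add]; abel)
      (fun c x z => by
        rw [map_smul, map_smul, smul_comm, smul_comm x c (s z), map_smul, ← smul_sub])
  have hd : ∀ x y, d x (π y) = x • G y - G (x • y) := key
  obtain ⟨τ, hτ⟩ := inner d
    (fun x x' z => by
      obtain ⟨y, rfl⟩ := hπ z
      rw [← map_smul π, hd, hd, hd, mul_smul, mul_smul, smul_sub]
      abel)
    (LinearMap.ext fun z => by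
      obtain ⟨y, rfl⟩ := hπ z
      rw [hd, hGa, sub_self, LinearMap.zero_apply])
  refine ⟨{ toFun := fun y => G y - τ (π y), map_add' := fun y y' => ?_,
            map_smul' := fun x y => ?_ }, fun x => ?_⟩
  · simp only [map_add]
    abel
  · have h := hτ x (π y)
    rw [hd, ← map_smul π] at h
    rw [RingHom.id_apply, smul_sub, sub_eq_sub_iff_sub_eq_sub, ← neg_sub, h, neg_sub]
  · change G (f x) - τ (π (f x)) = k x
    rw [hG, (hfπ _).2 ⟨x, rfl⟩, map_zero, sub_zero]

/-- A surjection `Y → Q` with kernel `Z` splits if the derivations with values in the `K`-linear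
maps from `Q` to `Z` are inner. -/
theorem exists_section_of_inner (ha : a * a = a) (f : Z →ₗ[A] Y) (hf : Function.Injective f)
    (q : Y →ₗ[A] Q) (hq : Function.Surjective q) (hfq : Function.Exact f q)
    (inner : ∀ d : A →ₗ[K] Q →ₗ[K] Z, (∀ x x' n, d (x * x') n = x • d x' n + d x (x' • n)) →
      d a = 0 → ∃ τ : Q →ₗ[K] Z, ∀ x n, d x n = x • τ n - τ (x • n)) :
    ∃ s : Q →ₗ[A] Y, ∀ n, q (s n) = n := by
  have := IsScalarTower.to_smulCommClass (R := K) (A := A) (M := Y)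
  have := IsScalarTower.to_smulCommClass (R := K) (A := A) (M := Q)
  obtain ⟨G, hG, hGa⟩ := exists_linear_lift K ha q hq LinearMap.id
  simp only [LinearMap.id_apply] at hG
  obtain ⟨r, hr⟩ := (f.restrictScalars K).exists_leftInverse_of_injective
    (LinearMap.ker_eq_bot.2 hf)
  have hr' : ∀ x, r (f x) = x := fun x => LinearMap.congr_fun hr x
  let d : A →ₗ[K] Q →ₗ[K] Z :=
    LinearMap.mk₂ K (fun x n => r (x • G n - G (x • n)))
      (fun x x' z => by simp only [add_smul, map_add, map_sub]; abel)
      (fun c x z => by rw [smul_assoc, smul_assoc, map_smul G, ← smul_sub, map_smul])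
      (fun x z z' => by simp only [smul_add, map_add, map_sub]; abel)
      (fun c x z => by
        rw [map_smul, smul_comm, smul_comm x c z, map_smul, ← smul_sub, map_smul])
  have hd : ∀ x n, f (d x n) = x • G n - G (x • n) := by
    intro x n
    change f (r (x • G n - G (x • n))) = _
    obtain ⟨t, ht⟩ := (hfq (x • G n - G (x • n))).1 (by
      rw [map_sub, map_smul, hG, hG, sub_self])
    rw [← ht, hr']
  obtain ⟨τ, hτ⟩ := inner d
    (fun x x' n => hf (by
      rw [map_add, map_smul, hd, hd, hd, mul_smul, mul_smul, smul_sub]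
      abel))
    (LinearMap.ext fun n => hf (by rw [hd, hGa, sub_self, LinearMap.zero_apply, map_zero]))
  refine ⟨{ toFun := fun n => G n - f (τ n), map_add' := fun n n' => ?_,
            map_smul' := fun x n => ?_ }, fun n => ?_⟩
  · simp only [map_add]
    abel
  · have h := congrArg f (hτ x n)
    rw [hd, map_sub f, map_smul f] at h
    rw [RingHom.id_apply, smul_sub, sub_eq_sub_iff_sub_eq_sub, ← neg_sub, h, neg_sub]
  · change q (G n - f (τ n)) = n
    rw [map_sub, hG, (hfq _).2 ⟨_, rfl⟩, sub_zero]

end Derivation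

namespace Gluing

variable {K : Type w} {A : Type uA} {B : Type uB} {Λ : Type u} [Field K] [Ring A]
    [Algebra K A] [Ring B] [Algebra K B] [Ring Λ] [Algebra K Λ] (g : Gluing K A B Λ)

/-! ### Restriction to the glued algebras -/

/-- The inflation of an `A`-module along the retraction `Λ → A` keeps its `K`-structure. -/
theorem isScalarTower_inflation {Z : Type*} [AddCommGroup Z] [Module K Z] [Module A Z]
    [IsScalarTower K A Z] :
    letI : Module Λ Z := Module.compHom Z g.retrA.toRingHom
    IsScalarTower K Λ Z := by
  let : Module Λ Z := Module.compHom Z g.retrA.toRingHom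
  refine ⟨fun c x m => ?_⟩
  change g.retrA (c • x) • m = c • g.retrA x • m
  rw [map_smul, smul_assoc]

section

variable {Z M : Type u} [AddCommGroup Z] [Module K Z] [Module A Z] [IsScalarTower K A Z]
  [AddCommGroup M] [Module K M] [Module Λ M] [IsScalarTower K Λ M]

theorem derivation_one {Z Q : Type*} [AddCommGroup Z] [Module K Z] [Module A Z]
    [AddCommGroup Q] [Module K Q] [Module A Q] (d : A →ₗ[K] Z →ₗ[K] Q)
    (hd : ∀ x x' z, d (x * x') z = x • d x' z + d x (x' • z)) : d 1 = 0 :=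
  LinearMap.ext fun z => by simpa using hd 1 1 z

/-- For an injective `Λ`-module `M` there are no nontrivial extensions of an `A`-module `Z` by the
restriction of `M`, expressed through derivations: `Z` is the restriction of its inflation. -/
theorem exists_inner_corner_of_injective [Module.Injective Λ M]
    (d : A →ₗ[K] Z →ₗ[K] Corner g.inA M)
    (hd : ∀ x x' z, d (x * x') z = x • d x' z + d x (x' • z)) (hd_a : d g.a = 0) :
    ∃ τ : Z →ₗ[K] Corner g.inA M, ∀ x z, d x z = x • τ z - τ (x • z) := by
  let : Module Λ Z := Module.compHom Z g.retrA.toRingHom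
  have : IsScalarTower K Λ Z := g.isScalarTower_inflation
  have hZ : ∀ x (z : Z), g.inA x • z = x • z := fun x z => by
    change g.retrA (g.inA x) • z = x • z
    rw [g.retrA_inA]
  obtain ⟨σ, hσ, -⟩ := g.exists_inner_of_injective
    (d.compr₂ (Corner.valₗ (K := K) : Corner g.inA M →ₗ[K] M))
    (fun x x' z => by simp [hd, hZ])
    (LinearMap.ext fun z => by simp [hd_a])
    (LinearMap.ext fun z => by simp [derivation_one d hd])
  refine ⟨Corner.projₗ ∘ₗ σ, fun x z => Corner.val_injective ?_⟩
  have h := hσ x z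
  rw [hZ] at h
  rw [LinearMap.compr₂_apply, Corner.valₗ_apply] at h
  rw [← Corner.one_smul_val (d x z), h]
  simp only [LinearMap.comp_apply, Corner.projₗ_apply, map_sub, Corner.val_smul, Corner.val_proj,
    smul_sub, Corner.map_mul_one_smul, Corner.one_smul_map]

/-- For a projective `Λ`-module `M` there are no nontrivial extensions of the restriction of `M` by
an `A`-module `Z`, expressed through derivations. -/
theorem exists_inner_corner_of_projective [Module.Projective Λ M]
    (d : A →ₗ[K] Corner g.inA M →ₗ[K] Z)
    (hd : ∀ x x' m, d (x * x') m = x • d x' m + d x (x' • m)) (hd_a : d g.a = 0) :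
    ∃ τ : Corner g.inA M →ₗ[K] Z, ∀ x m, d x m = x • τ m - τ (x • m) := by
  let : Module Λ Z := Module.compHom Z g.retrA.toRingHom
  have : IsScalarTower K Λ Z := g.isScalarTower_inflation
  have hZ : ∀ x (z : Z), g.inA x • z = x • z := fun x z => by
    change g.retrA (g.inA x) • z = x • z
    rw [g.retrA_inA]
  obtain ⟨σ, hσ, -⟩ := g.exists_inner_of_projective
    (d.compl₂ (Corner.projₗ : M →ₗ[K] Corner g.inA M))
    (fun x x' z => by simp [hd, hZ, Corner.proj_map_smul])
    (LinearMap.ext fun z => by simp [hd_a])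
    (LinearMap.ext fun z => by simp [derivation_one d hd])
  refine ⟨σ ∘ₗ Corner.valₗ, fun x m => ?_⟩
  have h := hσ x (Corner.val m)
  rw [hZ, LinearMap.compl₂_apply, Corner.projₗ_apply, Corner.proj_val] at h
  exact h

end

/-- The restriction of an injective `Λ`-module to `A` is injective, since every `A`-module is the
restriction of its inflation along the retraction. -/
theorem injective_corner (I : Type u) [AddCommGroup I] [Module Λ I] [Module.Injective Λ I] :
    Module.Injective A (Corner g.inA I) where
  out X Y _ _ _ _ f hf k := by
    let : Module K I := Module.compHom I (algebraMap K Λ)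
    have := isScalarTower_compHom K (R := Λ) I
    let : Module K X := Module.compHom X (algebraMap K A)
    have := isScalarTower_compHom K (R := A) X
    let : Module K Y := Module.compHom Y (algebraMap K A)
    have := isScalarTower_compHom K (R := A) Y
    refine exists_extension_of_inner K g.a_mul_self f hf (LinearMap.range f).mkQ
      (Submodule.mkQ_surjective _) (LinearMap.exact_map_mkQ_range f) k fun d hd hd_a => ?_
    exact g.exists_inner_corner_of_injective d hd hd_a

/-- The restriction of a projective `Λ`-module to `A` is projective: every surjection onto it
splits. -/
theorem exists_corner_section (N : Type u) [AddCommGroup N] [Module Λ N] [Module.Projective Λ N]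
    {Y : Type u} [AddCommGroup Y] [Module A Y] (q : Y →ₗ[A] Corner g.inA N)
    (hq : Function.Surjective q) : ∃ s : Corner g.inA N →ₗ[A] Y, ∀ n, q (s n) = n := by
  let : Module K N := Module.compHom N (algebraMap K Λ)
  have := isScalarTower_compHom K (R := Λ) N
  let : Module K Y := Module.compHom Y (algebraMap K A)
  have := isScalarTower_compHom K (R := A) Y
  refine exists_section_of_inner K g.a_mul_self (LinearMap.ker q).subtype
    (Submodule.subtype_injective _) q hq (LinearMap.exact_subtype_ker_map q) fun d hd hd_a => ?_
  exact g.exists_inner_corner_of_projective d hd hd_a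

/-- If the restriction of `C` to `A` is injective, then a `Λ`-linear map to `C` extends to an
`A`-linear map which is supported on the restrictions to `A`. -/
theorem exists_extension_of_injective_corner {C X Y : Type u} [AddCommGroup C] [Module Λ C]
    [Module K C] [IsScalarTower K Λ C] [AddCommGroup X] [Module Λ X] [AddCommGroup Y] [Module Λ Y]
    [Module K Y] [IsScalarTower K Λ Y] [hC : Module.Injective A (Corner g.inA C)] (f : X →ₗ[Λ] Y)
    (hf : Function.Injective f) (k : X →ₗ[Λ] C) : ∃ G : Y →ₗ[K] C,
      (∀ x y, G (g.inA x • y) = g.inA x • G y) ∧ (∀ y, g.inA 1 • G y = G y) ∧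
      ∀ x, G (f x) = g.inA 1 • k x := by
  obtain ⟨h, hh⟩ := hC.out (Corner.map g.inA f) (Corner.map_injective hf) (Corner.map g.inA k)
  refine ⟨{ toFun := fun y => Corner.val (h (Corner.proj y)),
            map_add' := fun y y' => ?_, map_smul' := fun c y => ?_ }, fun x y => ?_,
          fun y => Corner.one_smul_val _, fun x => ?_⟩
  · rw [← map_add, ← map_add]
    congr 2
    exact Corner.val_injective (by simp)
  · have h1 : (Corner.proj (c • y) : Corner g.inA Y) = (c • (1 : A)) • Corner.proj y :=
      Corner.val_injective (by
        rw [Corner.val_smul, map_smul, smul_assoc, Corner.val_proj, Corner.val_proj,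
          Corner.one_smul_map]
        have := IsScalarTower.to_smulCommClass (R := K) (A := Λ) (M := Y)
        rw [smul_comm])
    rw [h1, map_smul, Corner.val_smul, map_smul, smul_assoc, Corner.one_smul_val]
    rfl
  · change Corner.val (h (Corner.proj (g.inA x • y))) = g.inA x • Corner.val (h (Corner.proj y))
    rw [Corner.proj_map_smul, map_smul, Corner.val_smul]
  · have h1 : (Corner.proj (f x) : Corner g.inA Y) = Corner.map g.inA f (Corner.proj x) :=
      Corner.val_injective (by simp)
    change Corner.val (h (Corner.proj (f x))) = _
    rw [h1, hh, Corner.val_map, Corner.val_proj, map_smul]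

end Gluing

namespace Gluing

variable {K : Type w} {A : Type uA} {B : Type uB} {Λ : Type u} [Field K] [Ring A]
    [Algebra K A] [Ring B] [Algebra K B] [Ring Λ] [Algebra K Λ] (g : Gluing K A B Λ)

theorem inA_mul_inA_a (x : A) : g.inA x * g.inA g.a = g.inA x * g.inB 1 := by
  rw [← g.pair.mul_eq, ← mul_assoc, inA_mul_one]

theorem inA_a_mul_inA (x : A) : g.inA g.a * g.inA x = g.inB 1 * g.inA x := by
  rw [← g.pair.mul_eq', mul_assoc, inA_one_mul]

theorem inB_mul_inA_one (y : B) : g.inB y * g.inA 1 = g.inB y * g.inA g.a := by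
  rw [← g.pair.mul_eq', ← mul_assoc, inB_mul_one]

theorem inA_one_mul_inB (y : B) : g.inA 1 * g.inB y = g.inA g.a * g.inB y := by
  rw [← g.pair.mul_eq, mul_assoc, inB_one_mul]

/-- A quotient `C` of an injective `Λ`-module is injective as soon as its restrictions to `A` and to
`B` are. Extensions of a given map over `A` and over `B` are patched to a `K`-linear map which
commutes with `B`; they differ at the common vertex, and the failure of the patched map to commute
with `A` is the commutator with this difference. Lifted to the injective module, this derivation
becomes inner. -/
theorem injective_of_injective_corner {I C : Type u} [AddCommGroup I] [Module Λ I]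
    [Module.Injective Λ I] [AddCommGroup C] [Module Λ C] (p : I →ₗ[Λ] C)
    (hp : Function.Surjective p) [Module.Injective A (Corner g.inA C)]
    [Module.Injective B (Corner g.inB C)] : Module.Injective Λ C where
  out X Y _ _ _ _ f hf k := by
    let : Module K I := Module.compHom I (algebraMap K Λ)
    have := isScalarTower_compHom K (R := Λ) I
    let : Module K C := Module.compHom C (algebraMap K Λ)
    have := isScalarTower_compHom K (R := Λ) C
    let : Module K Y := Module.compHom Y (algebraMap K Λ)
    have := isScalarTower_compHom K (R := Λ) Y
    obtain ⟨GA, hGA, hGA1, hGAf⟩ := g.exists_extension_of_injective_corner (K := K) f hf k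
    have : Module.Injective B (Corner g.symm.inA C) := inferInstanceAs
      (Module.Injective B (Corner g.inB C))
    obtain ⟨GB, hGB, hGB1, hGBf⟩ := g.symm.exists_extension_of_injective_corner (K := K) f hf k
    change ∀ x y, GB (g.inB x • y) = g.inB x • GB y at hGB
    change ∀ y, g.inB 1 • GB y = GB y at hGB1
    change ∀ x, GB (f x) = g.inB 1 • k x at hGBf
    have hGAl : ∀ (l : Λ) y, l • GA y = (l * g.inA 1) • GA y := fun l y => by
      rw [mul_smul, hGA1]
    have hGAr : ∀ y, GA y = GA (g.inA 1 • y) := fun y => by rw [hGA, hGA1]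
    have hGBl : ∀ (l : Λ) y, l • GB y = (l * g.inB 1) • GB y := fun l y => by
      rw [mul_smul, hGB1]
    have hGBr : ∀ y, GB y = GB (g.inB 1 • y) := fun y => by rw [hGB, hGB1]
    have hGBa : ∀ y, GB (g.inA g.a • y) = g.inA g.a • GB y := fun y => by
      rw [g.pair.map_eq, hGB]
    -- The patched map: `GB` on the second algebra, `GA` away from the common vertex.
    let H : Y →ₗ[K] C := GA - GA ∘ₗ Algebra.lsmul K K Y (g.inA g.a) + GB
    have hH : ∀ y, H y = GA y - GA (g.inA g.a • y) + GB y := fun _ => rfl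
    have hHf : ∀ x, H (f x) = k x := fun x => by
      rw [hH, hGA, hGAf, hGBf, smul_smul, inA_mul_one, ← sub_smul, ← add_smul,
        sub_add_eq_add_sub, g.pair.add_eq, add_sub_cancel_right, one_smul]
    have hHB : ∀ y m, H (g.inB y • m) = g.inB y • H m := fun y m => by
      have h1 : GA (g.inB y • m) = GA (g.inA g.a • g.inB y • m) := by
        rw [hGAr, smul_smul, inA_one_mul_inB, mul_smul]
      have h2 : g.inB y • GA m = g.inB y • GA (g.inA g.a • m) := by
        rw [hGA, hGAl, inB_mul_inA_one, mul_smul]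
      rw [hH, hH, h1, sub_self, zero_add, smul_add, smul_sub, h2, sub_self, zero_add, hGB]
    -- The difference of the two extensions at the common vertex.
    let D : Y →ₗ[K] C := (GB - GA) ∘ₗ Algebra.lsmul K K Y (g.inA g.a)
    have hD : ∀ y, D y = GB (g.inA g.a • y) - GA (g.inA g.a • y) := fun _ => rfl
    have hHA : ∀ x m, H (g.inA x • m) - g.inA x • H m = D (g.inA x • m) - g.inA x • D m := by
      intro x m
      have h1 : GB (g.inA x • m) = GB (g.inA g.a • g.inA x • m) := by
        rw [hGBr, smul_smul, smul_smul, inA_a_mul_inA]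
      have h2 : g.inA x • GB m = g.inA x • GB (g.inA g.a • m) := by
        rw [hGBa, smul_smul, inA_mul_inA_a, hGBl]
      rw [hH, hH, hD, hD, h1, smul_add, smul_sub, smul_sub, h2, hGA x m]
      abel
    have hDf : ∀ x, D (f x) = 0 := fun x => by
      rw [hD, hGBa, hGA, hGAf, hGBf, smul_smul, smul_smul, g.pair.map_eq, inB_mul_one,
        ← g.pair.map_eq, inA_mul_one, sub_self]
    have hDa : ∀ y, D (g.inA g.a • y) = D y := fun y => by
      rw [hD, hD, smul_smul, inA_a_mul_self]
    have hDa' : ∀ y, g.inA g.a • D y = D y := fun y => by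
      rw [hD, smul_sub, ← hGBa, ← hGA, smul_smul, inA_a_mul_self]
    let Z : Type u := Y ⧸ LinearMap.range f
    let π : Y →ₗ[Λ] Z := (LinearMap.range f).mkQ
    have hπ : Function.Surjective π := Submodule.mkQ_surjective _
    obtain ⟨s, hs⟩ := (π.restrictScalars K).exists_rightInverse_of_surjective
      (LinearMap.range_eq_top.2 hπ)
    have hs' : ∀ z, π (s z) = z := fun z => LinearMap.congr_fun hs z
    have hDs : ∀ y, D (s (π y)) = D y := fun y => by
      obtain ⟨t, ht⟩ := (LinearMap.exact_map_mkQ_range f (s (π y) - y)).1 (by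
        change π (s (π y) - y) = 0
        rw [map_sub, hs', sub_self])
      rw [eq_add_of_sub_eq ht.symm, map_add, hDf, zero_add]
    obtain ⟨t, ht⟩ := (p.restrictScalars K).exists_rightInverse_of_surjective
      (LinearMap.range_eq_top.2 hp)
    have ht' : ∀ c, p (t c) = c := fun c => LinearMap.congr_fun ht c
    -- The lift of the difference to the injective module, cut down to the common vertex.
    let E : Z →ₗ[K] I := Algebra.lsmul K K I (g.inA g.a) ∘ₗ t ∘ₗ D ∘ₗ s ∘ₗ
      Algebra.lsmul K K Z (g.inA g.a)
    have hE : ∀ z, E z = g.inA g.a • t (D (s (g.inA g.a • z))) := fun _ => rfl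
    have hEa : ∀ z, E (g.inA g.a • z) = E z := fun z => by
      rw [hE, hE, smul_smul, inA_a_mul_self]
    have hEa' : ∀ z, g.inA g.a • E z = E z := fun z => by
      rw [hE, smul_smul, inA_a_mul_self]
    have hE1 : ∀ z, E (g.inA 1 • z) = E z := fun z => by
      rw [← hEa, smul_smul, inA_mul_one, hEa]
    have hE1' : ∀ z, g.inA 1 • E z = E z := fun z => by
      rw [← hEa', smul_smul, inA_one_mul]
    have hpE : ∀ y, p (E (π y)) = D y := fun y => by
      rw [hE, map_smul, ht', ← map_smul π, hDs, hDa, hDa']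
    let d : A →ₗ[K] Z →ₗ[K] I :=
      LinearMap.mk₂ K (fun x z => E (g.inA x • z) - g.inA x • E z)
        (fun x x' z => by simp only [add_smul, map_add]; abel)
        (fun c x z => by
          rw [map_smul g.inA, smul_assoc, smul_assoc, E.map_smul, ← smul_sub])
        (fun x z z' => by simp only [smul_add, map_add]; abel)
        (fun c x z => by
          have := IsScalarTower.to_smulCommClass (R := K) (A := Λ) (M := Z)
          have := IsScalarTower.to_smulCommClass (R := K) (A := Λ) (M := I)
          rw [E.map_smul, smul_comm _ c z, smul_comm _ c (E z), E.map_smul, ← smul_sub])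
    have hd : ∀ x z, d x z = E (g.inA x • z) - g.inA x • E z := fun _ _ => rfl
    obtain ⟨σ, hσA, hσB⟩ := g.exists_inner_of_injective d
      (fun x x' z => by
        simp only [hd, map_mul, mul_smul, smul_sub]
        abel)
      (LinearMap.ext fun z => by rw [hd, hEa, hEa', sub_self, LinearMap.zero_apply])
      (LinearMap.ext fun z => by rw [hd, hE1, hE1', sub_self, LinearMap.zero_apply])
    let F : Y →ₗ[K] C := H + p.restrictScalars K ∘ₗ σ ∘ₗ π.restrictScalars K
    have hF : ∀ y, F y = H y + p (σ (π y)) := fun _ => rfl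
    refine ⟨{ F with map_smul' := g.map_smul_of_commute F (fun x m => ?_) (fun y m => ?_) },
      fun x => ?_⟩
    · have h := congrArg p (hσA x (π m))
      rw [hd, map_sub, map_sub, map_smul p, map_smul p, ← map_smul π, hpE, hpE, ← hHA] at h
      rw [hF, hF, smul_add, add_comm (g.inA x • H m)]
      exact sub_eq_sub_iff_add_eq_add.1 h
    · rw [hF, hF, hHB, map_smul π, hσB, map_smul p, smul_add]
    · have h0 : π (f x) = 0 := (Submodule.Quotient.mk_eq_zero _).2 ⟨x, rfl⟩
      change H (f x) + p (σ (π (f x))) = k x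
      rw [hHf, h0, map_zero, map_zero, add_zero]

end Gluing

/-! ### Injective dimensions -/

section Dimension

variable {R : Type v} [Ring R]

/-- Every module embeds into an injective one. -/
theorem exists_injective_embedding [Small.{u} R] (M : Type u) [AddCommGroup M] [Module R M] :
    ∃ (I : Type u) (_ : AddCommGroup I) (_ : Module R I) (f : M →ₗ[R] I),
      Function.Injective f ∧ Module.Injective R I := by
  obtain ⟨I, _, f, hf⟩ := EnoughInjectives.presentation (ModuleCat.of R M)
  exact ⟨I, inferInstance, inferInstance, f.hom, (ModuleCat.mono_iff_injective f).1 hf,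
    Module.injective_module_of_injective_object R I⟩

theorem hasInjectiveDimensionLT_one_iff (M : Type u) [AddCommGroup M] [Module R M] :
    HasInjectiveDimensionLT (ModuleCat.of R M) 1 ↔ Module.Injective R M := by
  rw [← injective_iff_hasInjectiveDimensionLT_one, Module.injective_iff_injective_object]

/-- Dimension shifting along an embedding into an injective module. -/
theorem hasInjectiveDimensionLT_shift {M I C : Type u} [AddCommGroup M] [Module R M]
    [AddCommGroup I] [Module R I] [Module.Injective R I] [AddCommGroup C] [Module R C]
    (f : M →ₗ[R] I) (p : I →ₗ[R] C) (hf : Function.Injective f) (hp : Function.Surjective p)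
    (h : Function.Exact f p) (n : ℕ) :
    HasInjectiveDimensionLT (ModuleCat.of R C) (n + 1) ↔
      HasInjectiveDimensionLT (ModuleCat.of R M) (n + 2) := by
  let S : ShortComplex (ModuleCat.{u} R) :=
    ModuleCat.shortComplexOfCompEqZero f p h.linearMap_comp_eq_zero
  have hS : S.ShortExact := ModuleCat.shortComplex_shortExact S h hf hp
  exact hS.hasInjectiveDimensionLT_X₃_iff n (Module.injective_object_of_injective_module R I)

theorem hasInjectiveDimensionLT_of_retract {M N : Type u} [AddCommGroup M] [Module R M]
    [AddCommGroup N] [Module R N] (i : M →ₗ[R] N) (r : N →ₗ[R] M) (h : ∀ m, r (i m) = m) (n : ℕ)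
    (hN : HasInjectiveDimensionLT (ModuleCat.of R N) n) :
    HasInjectiveDimensionLT (ModuleCat.of R M) n :=
  Retract.hasInjectiveDimensionLT (X := ModuleCat.of R M) (Y := ModuleCat.of R N)
    ⟨ModuleCat.ofHom i, ModuleCat.ofHom r, by ext m; exact h m⟩ n

theorem hasInjectiveDimensionLT_pi (M : Type u) [AddCommGroup M] [Module R M] (n : ℕ)
    (hM : HasInjectiveDimensionLT (ModuleCat.of R M) n) (k : ℕ) :
    HasInjectiveDimensionLT (ModuleCat.of R (Fin k → M)) n := by
  induction k with
  | zero =>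
    have := ModuleCat.isZero_of_subsingleton (ModuleCat.of R (Fin 0 → M))
    have := this.hasInjectiveDimensionLT_zero
    exact hasInjectiveDimensionLT_of_ge _ 0 n (Nat.zero_le n)
  | succ k ih =>
    let f : M →ₗ[R] (Fin (k + 1) → M) := LinearMap.single R (fun _ => M) 0
    let p : (Fin (k + 1) → M) →ₗ[R] (Fin k → M) := LinearMap.funLeft R M Fin.succ
    have h : Function.Exact f p := by
      intro y
      constructor
      · intro hy
        refine ⟨y 0, funext fun j => ?_⟩
        induction j using Fin.cases with
        | zero => simp [f]
        | succ j =>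
          have := congrFun hy j
          simpa [f, p, LinearMap.funLeft_apply] using this.symm
      · rintro ⟨m, rfl⟩
        ext j
        simp [f, p, LinearMap.funLeft_apply]
    let S : ShortComplex (ModuleCat.{u} R) :=
      ModuleCat.shortComplexOfCompEqZero f p h.linearMap_comp_eq_zero
    have hS : S.ShortExact := ModuleCat.shortComplex_shortExact S h
      (Pi.single_injective (M := fun _ : Fin (k + 1) => M) 0)
      (LinearMap.funLeft_surjective_of_injective R M _ (Fin.succ_injective k))
    exact hS.hasInjectiveDimensionLT_X₂ n hM ih

end Dimension

namespace Gluing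

variable {K : Type w} {A : Type uA} {B : Type uB} {Λ : Type u} [Field K] [Ring A]
    [Algebra K A] [Ring B] [Algebra K B] [Ring Λ] [Algebra K Λ] (g : Gluing K A B Λ)

/-- Restriction to `A` does not increase the injective dimension. -/
theorem hasInjectiveDimensionLT_corner (n : ℕ) (M : Type u) [AddCommGroup M] [Module Λ M]
    (h : HasInjectiveDimensionLT (ModuleCat.of Λ M) (n + 1)) :
    HasInjectiveDimensionLT (ModuleCat.of A (Corner g.inA M)) (n + 1) := by
  induction n generalizing M with
  | zero =>
    have := (hasInjectiveDimensionLT_one_iff (R := Λ) M).1 h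
    exact (hasInjectiveDimensionLT_one_iff _).2 (g.injective_corner M)
  | succ n ih =>
    obtain ⟨I, _, _, f, hf, _⟩ := exists_injective_embedding (R := Λ) M
    have := g.injective_corner I
    have hp := Submodule.mkQ_surjective (LinearMap.range f)
    have he := LinearMap.exact_map_mkQ_range f
    exact (hasInjectiveDimensionLT_shift _ _ (Corner.map_injective hf)
      (Corner.map_surjective hp) (Corner.map_exact he) n).1
      (ih _ ((hasInjectiveDimensionLT_shift f _ hf hp he n).2 h))

/-- The injective dimension of a `Λ`-module is at most the maximum of `1` and the injective
dimensions of its two restrictions. -/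
theorem hasInjectiveDimensionLT_of_corner (n : ℕ) (M : Type u) [AddCommGroup M] [Module Λ M]
    (hA : HasInjectiveDimensionLT (ModuleCat.of A (Corner g.inA M)) (n + 2))
    (hB : HasInjectiveDimensionLT (ModuleCat.of B (Corner g.inB M)) (n + 2)) :
    HasInjectiveDimensionLT (ModuleCat.of Λ M) (n + 2) := by
  induction n generalizing M with
  | zero =>
    obtain ⟨I, _, _, f, hf, _⟩ := exists_injective_embedding (R := Λ) M
    have := g.injective_corner I
    have : Module.Injective B (Corner g.inB I) := g.symm.injective_corner I
    have hp := Submodule.mkQ_surjective (LinearMap.range f)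
    have he := LinearMap.exact_map_mkQ_range f
    have hA' := (hasInjectiveDimensionLT_one_iff _).1 <|
      (hasInjectiveDimensionLT_shift _ _ (Corner.map_injective hf)
      (Corner.map_surjective hp) (Corner.map_exact he) 0).2 hA
    have hB' := (hasInjectiveDimensionLT_one_iff _).1 <|
      (hasInjectiveDimensionLT_shift _ _ (Corner.map_injective hf)
      (Corner.map_surjective hp) (Corner.map_exact he) 0).2 hB
    exact (hasInjectiveDimensionLT_shift f _ hf hp he 0).1
      ((hasInjectiveDimensionLT_one_iff _).2 (g.injective_of_injective_corner _ hp))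
  | succ n ih =>
    obtain ⟨I, _, _, f, hf, _⟩ := exists_injective_embedding (R := Λ) M
    have := g.injective_corner I
    have : Module.Injective B (Corner g.inB I) := g.symm.injective_corner I
    have hp := Submodule.mkQ_surjective (LinearMap.range f)
    have he := LinearMap.exact_map_mkQ_range f
    exact (hasInjectiveDimensionLT_shift f _ hf hp he (n + 1)).1 (ih _
      ((hasInjectiveDimensionLT_shift _ _ (Corner.map_injective hf)
        (Corner.map_surjective hp) (Corner.map_exact he) (n + 1)).2 hA)
      ((hasInjectiveDimensionLT_shift _ _ (Corner.map_injective hf)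
        (Corner.map_surjective hp) (Corner.map_exact he) (n + 1)).2 hB))

variable [Small.{u} A]

/-- The algebra `A` is a retract of the restriction of the regular `Λ`-module. -/
theorem hasInjectiveDimensionLT_left (g : Gluing K A B Λ) (n : ℕ)
    (h : HasInjectiveDimensionLT (ModuleCat.of Λ Λ) (n + 1)) :
    HasInjectiveDimensionLT (ModuleCat.of A A) (n + 1) := by
  let e : Shrink.{u} A ≃ₗ[A] A := Shrink.linearEquiv A A
  refine (ModuleCat.hasInjectiveDimensionLE_iff_of_linearEquiv.{u, uA}
    (M := ModuleCat.of A (Shrink.{u} A)) (N := ModuleCat.of A A) e n).1 ?_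
  let i : A →ₗ[A] Corner g.inA Λ :=
    { toFun := fun x => Corner.mk (g.inA x) (g.inA_one_mul x)
      map_add' := fun x y => Corner.val_injective (by simp)
      map_smul' := fun x y => Corner.val_injective (by simp) }
  let r : Corner g.inA Λ →ₗ[A] A :=
    { toFun := fun c => g.retrA (Corner.val c)
      map_add' := fun x y => by simp
      map_smul' := fun x y => by simp [g.retrA_inA] }
  exact hasInjectiveDimensionLT_of_retract (i ∘ₗ e.toLinearMap) (e.symm.toLinearMap ∘ₗ r)
    (fun m => by
      change e.symm (g.retrA (g.inA (e m))) = m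
      rw [g.retrA_inA, e.symm_apply_apply]) (n + 1) (g.hasInjectiveDimensionLT_corner n Λ h)

/-- The restriction of the regular `Λ`-module to `A` is a retract of a finite free module. -/
theorem hasInjectiveDimensionLT_corner_self (g : Gluing K A B Λ) [Module.Finite K Λ]
    (n : ℕ)
    (h : HasInjectiveDimensionLT (ModuleCat.of A A) (n + 1)) :
    HasInjectiveDimensionLT (ModuleCat.of A (Corner g.inA Λ)) (n + 1) := by
  let e : Shrink.{u} A ≃ₗ[A] A := Shrink.linearEquiv A A
  have h' : HasInjectiveDimensionLT (ModuleCat.of A (Shrink.{u} A)) (n + 1) :=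
    (ModuleCat.hasInjectiveDimensionLE_iff_of_linearEquiv.{u, uA}
    (M := ModuleCat.of A (Shrink.{u} A)) (N := ModuleCat.of A A) e n).2 h
  have : Module.Finite K (Corner g.inA Λ) :=
    Module.Finite.of_surjective (Corner.projₗ : Λ →ₗ[K] Corner g.inA Λ)
      fun c => ⟨Corner.val c, Corner.proj_val c⟩
  have : Module.Finite A (Corner g.inA Λ) := Module.Finite.of_restrictScalars_finite K A _
  obtain ⟨k, q, hq⟩ := Module.Finite.exists_fin' A (Corner g.inA Λ)
  let e' : (Fin k → Shrink.{u} A) ≃ₗ[A] (Fin k → A) := LinearEquiv.piCongrRight fun _ => e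
  obtain ⟨s, hs⟩ := g.exists_corner_section Λ (q ∘ₗ e'.toLinearMap)
    (hq.comp e'.surjective)
  exact hasInjectiveDimensionLT_of_retract s _ hs _ (hasInjectiveDimensionLT_pi _ _ h' k)

variable [Small.{u} B]

theorem hasInjectiveDimensionLT_self (g : Gluing K A B Λ) [Module.Finite K Λ]
    (n : ℕ)
    (hA : HasInjectiveDimensionLT (ModuleCat.of A A) (n + 2))
    (hB : HasInjectiveDimensionLT (ModuleCat.of B B) (n + 2)) :
    HasInjectiveDimensionLT (ModuleCat.of Λ Λ) (n + 2) :=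
  g.hasInjectiveDimensionLT_of_corner n Λ (g.hasInjectiveDimensionLT_corner_self _ hA)
    (g.symm.hasInjectiveDimensionLT_corner_self _ hB)

end Gluing

/-! ### Opposite algebras and self-injective dimensions -/

section Opposite

open MulOpposite

/-- A non-unital algebra homomorphism between the opposite algebras. -/
def nonUnitalOp {K A T : Type*} [Field K] [Ring A] [Algebra K A] [Ring T] [Algebra K T]
    (f : A →ₙₐ[K] T) : Aᵐᵒᵖ →ₙₐ[K] Tᵐᵒᵖ where
  toFun x := op (f (unop x))
  map_smul' c x := by simp
  map_zero' := by simp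
  map_add' x y := by simp
  map_mul' x y := by simp

/-- A non-unital algebra homomorphism from an opposite algebra, seen as a homomorphism to the
opposite algebra. -/
def nonUnitalOpComm {K A T : Type*} [Field K] [Ring A] [Algebra K A] [Ring T] [Algebra K T]
    (f : Aᵐᵒᵖ →ₙₐ[K] T) : A →ₙₐ[K] Tᵐᵒᵖ where
  toFun x := op (f (op x))
  map_smul' c x := by simp
  map_zero' := by simp
  map_add' x y := by simp
  map_mul' x y := by simp

variable {K : Type w} {A : Type uA} {B : Type uB} {Λ : Type u} [Field K] [Ring A]
    [Algebra K A] [Ring B] [Algebra K B] [Ring Λ] [Algebra K Λ] (g : Gluing K A B Λ)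

/-- The opposite algebra of a gluing is the gluing of the opposite algebras. -/
def Gluing.op : Gluing K Aᵐᵒᵖ Bᵐᵒᵖ Λᵐᵒᵖ where
  a := MulOpposite.op g.a
  b := MulOpposite.op g.b
  inA := nonUnitalOp g.inA
  inB := nonUnitalOp g.inB
  retrA := AlgHom.op g.retrA
  retrB := AlgHom.op g.retrB
  pair :=
    { map_eq := congrArg MulOpposite.op g.pair.map_eq
      mul_eq := congrArg MulOpposite.op g.pair.mul_eq'
      mul_eq' := congrArg MulOpposite.op g.pair.mul_eq
      add_eq := congrArg MulOpposite.op g.pair.add_eq }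
  retrA_inA x := congrArg MulOpposite.op (g.retrA_inA (unop x))
  retrB_inB y := congrArg MulOpposite.op (g.retrB_inB (unop y))
  adjoin_eq_top := by
    have h := Subalgebra.op_adjoin (R := K) (Set.range g.inA ∪ Set.range g.inB)
    rw [g.adjoin_eq_top, Subalgebra.op_top] at h
    rw [h]
    congr 1
    ext x
    constructor
    · rintro (⟨y, rfl⟩ | ⟨y, rfl⟩)
      · exact Or.inl ⟨unop y, rfl⟩
      · exact Or.inr ⟨unop y, rfl⟩
    · rintro (⟨y, hy⟩ | ⟨y, hy⟩)
      · exact Or.inl ⟨MulOpposite.op y, congrArg MulOpposite.op hy⟩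
      · exact Or.inr ⟨MulOpposite.op y, congrArg MulOpposite.op hy⟩
  lift T _ _ f f' h := by
    obtain ⟨φ, h₁, h₂⟩ := g.lift Tᵐᵒᵖ (nonUnitalOpComm f) (nonUnitalOpComm f')
      { map_eq := congrArg MulOpposite.op h.map_eq
        mul_eq := congrArg MulOpposite.op h.mul_eq'
        mul_eq' := congrArg MulOpposite.op h.mul_eq
        add_eq := congrArg MulOpposite.op h.add_eq }
    exact ⟨AlgHom.opComm φ, fun x => congrArg unop (h₁ (unop x)),
      fun y => congrArg unop (h₂ (unop y))⟩

theorem rightSelfInjDim_eq (R : Type u) [Ring R] : rightSelfInjDim R = leftSelfInjDim Rᵐᵒᵖ :=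
  ModuleCat.injectiveDimension_eq_of_linearEquiv (R := Rᵐᵒᵖ) (M := ModuleCat.of Rᵐᵒᵖ R)
    (N := ModuleCat.of Rᵐᵒᵖ Rᵐᵒᵖ) { MulOpposite.opAddEquiv with map_smul' := fun _ _ => rfl }

theorem leftSelfInjDim_eq_bot_iff (R : Type u) [Ring R] :
    leftSelfInjDim R = ⊥ ↔ Subsingleton R := by
  rw [leftSelfInjDim, injectiveDimension_eq_bot_iff, ModuleCat.isZero_iff_subsingleton]

theorem leftSelfInjDim_le_iff (R : Type u) [Ring R] (n : ℕ) :
    leftSelfInjDim R ≤ n ↔ HasInjectiveDimensionLT (ModuleCat.of R R) (n + 1) :=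
  injectiveDimension_le_iff _ n

namespace Gluing

theorem leftSelfInjDim_le [Small.{u} A] (g : Gluing K A B Λ) :
    leftSelfInjDim A ≤ leftSelfInjDim Λ := by
  have key : ∀ n : ℕ, leftSelfInjDim Λ ≤ n → leftSelfInjDim A ≤ n := fun n hn =>
    (leftSelfInjDim_le_iff A n).2 (g.hasInjectiveDimensionLT_left n
      ((leftSelfInjDim_le_iff Λ n).1 hn))
  generalize hd : leftSelfInjDim Λ = d at key
  induction d with
  | bot =>
    have := (leftSelfInjDim_eq_bot_iff Λ).1 hd
    have : Subsingleton A := ⟨fun x y => by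
      rw [← g.retrA_inA x, ← g.retrA_inA y, Subsingleton.elim (g.inA x) (g.inA y)]⟩
    exact ((leftSelfInjDim_eq_bot_iff A).2 this).le
  | coe d =>
    induction d with
    | top => exact le_top
    | coe n => exact key n le_rfl

theorem leftSelfInjDim_le_max [Small.{u} A] [Small.{u} B] (g : Gluing K A B Λ)
    [Module.Finite K Λ] :
    leftSelfInjDim Λ ≤ max (max (leftSelfInjDim A) (leftSelfInjDim B)) 1 := by
  generalize hd : max (max (leftSelfInjDim A) (leftSelfInjDim B)) 1 = d
  have hA : leftSelfInjDim A ≤ d := hd ▸ (le_max_left _ _).trans (le_max_left _ _)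
  have hB : leftSelfInjDim B ≤ d := hd ▸ (le_max_right _ _).trans (le_max_left _ _)
  have h1 : 1 ≤ d := hd ▸ le_max_right _ _
  induction d with
  | bot => exact absurd h1 (by decide)
  | coe d =>
    induction d with
    | top => exact le_top
    | coe n =>
      obtain _ | n := n
      · exact absurd h1 (by decide)
      · exact (leftSelfInjDim_le_iff Λ (n + 1)).2 (g.hasInjectiveDimensionLT_self n
          ((leftSelfInjDim_le_iff A (n + 1)).1 hA) ((leftSelfInjDim_le_iff B (n + 1)).1 hB))

/-- The Gorenstein property and dimension of a finite-dimensional gluing. -/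
theorem gorenstein [Small.{u} A] [Small.{u} B] (g : Gluing K A B Λ) [Module.Finite K Λ] :
    (IsGorenstein Λ ↔ IsGorenstein A ∧ IsGorenstein B) ∧
      max (gorensteinDim A) (gorensteinDim B) ≤ gorensteinDim Λ ∧
      gorensteinDim Λ ≤ max (max (gorensteinDim A) (gorensteinDim B)) 1 := by
  have : Small.{u} Aᵐᵒᵖ := small_map MulOpposite.opEquiv.symm
  have : Small.{u} Bᵐᵒᵖ := small_map MulOpposite.opEquiv.symm
  have : Module.Finite K Λᵐᵒᵖ := Module.Finite.equiv (MulOpposite.opLinearEquiv K)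
  have hA := g.leftSelfInjDim_le
  have hB := g.symm.leftSelfInjDim_le
  have hΛ := g.leftSelfInjDim_le_max
  have hA' := g.op.leftSelfInjDim_le
  have hB' := g.op.symm.leftSelfInjDim_le
  have hΛ' := g.op.leftSelfInjDim_le_max
  rw [← rightSelfInjDim_eq] at hA' hB' hΛ'
  rw [← rightSelfInjDim_eq] at hA' hB' hΛ'
  rw [← rightSelfInjDim_eq] at hΛ'
  have one_lt : (1 : WithBot ℕ∞) < ⊤ := by decide
  refine ⟨⟨fun h => ⟨⟨hA.trans_lt h.1, hA'.trans_lt h.2⟩, ⟨hB.trans_lt h.1, hB'.trans_lt h.2⟩⟩,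
    fun h => ⟨hΛ.trans_lt (max_lt (max_lt h.1.1 h.2.1) one_lt),
      hΛ'.trans_lt (max_lt (max_lt h.1.2 h.2.2) one_lt)⟩⟩,
    max_le (max_le_max hA hA') (max_le_max hB hB'), max_le (hΛ.trans ?_) (hΛ'.trans ?_)⟩
  · exact max_le_max (max_le_max (le_max_left _ _) (le_max_left _ _)) le_rfl
  · exact max_le_max (max_le_max (le_max_right _ _) (le_max_right _ _)) le_rfl

end Gluing

end Opposite

noncomputable section

/-! ### The universal property of path algebras -/

section Quotient

variable {K R T : Type*} [Field K] [Ring R] [Algebra K R] [Ring T] [Algebra K T]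

/-- A non-unital algebra homomorphism which vanishes on a two-sided ideal, on the quotient. -/
def nonUnitalQuotientLift (I : Ideal R) [I.IsTwoSided] (f : R →ₙₐ[K] T)
    (h : ∀ x ∈ I, f x = 0) : R ⧸ I →ₙₐ[K] T where
  toFun x := Quotient.liftOn' x f fun x y hxy => by
    rw [Submodule.quotientRel_def] at hxy
    rw [← sub_eq_zero, ← map_sub]
    exact h _ hxy
  map_smul' c x := by
    obtain ⟨x, rfl⟩ := Ideal.Quotient.mk_surjective x
    exact map_smul f c x
  map_zero' := map_zero f
  map_add' x y := by
    obtain ⟨x, rfl⟩ := Ideal.Quotient.mk_surjective x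
    obtain ⟨y, rfl⟩ := Ideal.Quotient.mk_surjective y
    exact map_add f x y
  map_mul' x y := by
    obtain ⟨x, rfl⟩ := Ideal.Quotient.mk_surjective x
    obtain ⟨y, rfl⟩ := Ideal.Quotient.mk_surjective y
    exact map_mul f x y

end Quotient

namespace PathAlgebra

variable {K : Type w} [Field K] {V : Type u} [Quiver.{v} V]

variable {T : Type*} [Ring T] [Algebra K T]

/-- A linear map from the path algebra is multiplicative if it is so on pairs of paths. -/
theorem map_mul_of_paths (L : PathAlgebra K V →ₗ[K] T)
    (h : ∀ (i j k : V) (p : Quiver.Path j k) (q : Quiver.Path i j),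
      L (ofPath K (q.comp p)) = L (ofPath K p) * L (ofPath K q))
    (h' : ∀ (i j j' k : V) (p : Quiver.Path j' k) (q : Quiver.Path i j), j ≠ j' →
      L (ofPath K p) * L (ofPath K q) = 0) (x y : PathAlgebra K V) : L (x * y) = L x * L y := by
  induction x using PathAlgebra.induction with
  | zero => rw [PathAlgebra.zero_mul', map_zero, zero_mul]
  | add x x' hx hx' => rw [PathAlgebra.add_mul', map_add, map_add, add_mul, hx, hx']
  | smul c i j p =>
    rw [PathAlgebra.smul_mul', map_smul, map_smul, smul_mul_assoc]
    congr 1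
    induction y using PathAlgebra.induction with
    | zero => rw [PathAlgebra.mul_zero', map_zero, mul_zero]
    | add y y' hy hy' => rw [PathAlgebra.mul_add', map_add, map_add, mul_add, hy, hy']
    | smul c i' j' q =>
      rw [PathAlgebra.mul_smul', map_smul, map_smul, mul_smul_comm]
      congr 1
      by_cases hij : j' = i
      · subst hij
        rw [ofPath_mul_ofPath, h]
      · rw [ofPath_mul_ofPath_of_ne _ _ hij, map_zero, h' _ _ _ _ _ _ hij]

theorem linearCombination_ofPath {M : Type*} [AddCommGroup M] [Module K M] (F : AnyPath V → M)
    {i j : V} (p : Quiver.Path i j) :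
    (Finsupp.linearCombination K F : PathAlgebra K V →ₗ[K] M) (ofPath K p) = F ⟨i, j, p⟩ := by
  rw [ofPath]
  erw [Finsupp.linearCombination_single, one_smul]

/-- The value of a path: the product of the values of its arrows, the last arrow leftmost as in the
path algebra, and of the idempotent of its source. -/
def evalPath (e : V → T) (t : ∀ {i j : V}, (i ⟶ j) → T) {i : V} : ∀ {j : V}, Quiver.Path i j → T
  | _, .nil => e i
  | _, .cons p α => t α * evalPath e t p

/-- A family of orthogonal idempotents indexed by the vertices and a compatible family of elements
indexed by the arrows. -/
structure IsQuiverFamily (e : V → T) (t : ∀ {i j : V}, (i ⟶ j) → T) : Prop where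
  mul_self : ∀ i, e i * e i = e i
  mul_of_ne : ∀ i j, i ≠ j → e i * e j = 0
  mul_left : ∀ {i j : V} (α : i ⟶ j), e j * t α = t α
  mul_right : ∀ {i j : V} (α : i ⟶ j), t α * e i = t α

namespace IsQuiverFamily

variable {e : V → T} {t : ∀ {i j : V}, (i ⟶ j) → T} (h : IsQuiverFamily e t)

include h

theorem evalPath_mul {i j : V} (p : Quiver.Path i j) :
    evalPath e t p * e i = evalPath e t p := by
  induction p with
  | nil => exact h.mul_self i
  | cons p α ih => rw [evalPath, mul_assoc, ih]

theorem mul_evalPath {i j : V} (p : Quiver.Path i j) :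
    e j * evalPath e t p = evalPath e t p := by
  cases p with
  | nil => exact h.mul_self i
  | cons p α => rw [evalPath, ← mul_assoc, h.mul_left]

theorem evalPath_comp {i j k : V} (q : Quiver.Path i j) (p : Quiver.Path j k) :
    evalPath e t (q.comp p) = evalPath e t p * evalPath e t q := by
  induction p with
  | nil => rw [Quiver.Path.comp_nil, evalPath, h.mul_evalPath]
  | cons p α ih => rw [Quiver.Path.comp_cons, evalPath, evalPath, ih, mul_assoc]

theorem evalPath_mul_of_ne {i j j' k : V} (p : Quiver.Path j' k) (q : Quiver.Path i j)
    (hj : j ≠ j') : evalPath e t p * evalPath e t q = 0 := by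
  rw [← h.evalPath_mul p, ← h.mul_evalPath q, mul_assoc, ← mul_assoc (e j') (e j),
    h.mul_of_ne _ _ hj.symm, zero_mul, mul_zero]

end IsQuiverFamily

theorem one_eq_sum [Fintype V] : (1 : PathAlgebra K V) = ∑ i : V, vertexIdem K i :=
  finsum_eq_sum_of_fintype _

theorem vertexIdem_mul_self (i : V) : vertexIdem K i * vertexIdem K i = vertexIdem K i :=
  ofPath_mul_ofPath _ _

theorem vertexIdem_mul_of_ne {i j : V} (h : i ≠ j) : vertexIdem K i * vertexIdem K j = 0 :=
  ofPath_mul_ofPath_of_ne _ _ h.symm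

theorem vertexIdem_mul_toPath {i j : V} (α : i ⟶ j) :
    vertexIdem K j * ofPath K α.toPath = ofPath K α.toPath := ofPath_mul_ofPath _ _

theorem toPath_mul_vertexIdem {i j : V} (α : i ⟶ j) :
    ofPath K α.toPath * vertexIdem K i = ofPath K α.toPath := ofPath_mul_ofPath _ _

variable (K) in
theorem ofPath_cons {i j k : V} (p : Quiver.Path i j) (α : j ⟶ k) :
    ofPath K (p.cons α) = ofPath K α.toPath * ofPath K p :=
  (ofPath_mul_ofPath α.toPath p).symm

theorem pathAlgebraMap_ofPath {W : Type*} [Quiver W] (F : V ⥤q W) {i j : V}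
    (p : Quiver.Path i j) : pathAlgebraMap K F (ofPath K p) = ofPath K (F.mapPath p) :=
  linearCombination_ofPath _ p

theorem pathAlgebraMap_mul {W : Type*} [Quiver W] [Finite W] (F : V ⥤q W)
    (hF : Function.Injective F.obj) (x y : PathAlgebra K V) :
    pathAlgebraMap K F (x * y) = pathAlgebraMap K F x * pathAlgebraMap K F y := by
  refine map_mul_of_paths (T := PathAlgebra K W) (pathAlgebraMap K F) ?_ ?_ x y
  · intro i j k p q
    rw [pathAlgebraMap_ofPath, pathAlgebraMap_ofPath, pathAlgebraMap_ofPath,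
      Prefunctor.mapPath_comp]
    exact (ofPath_mul_ofPath _ _).symm
  · intro i j j' k p q hj
    rw [pathAlgebraMap_ofPath, pathAlgebraMap_ofPath]
    exact ofPath_mul_ofPath_of_ne _ _ fun h => hj (hF h)

variable [Finite V]

/-- The universal property of the path algebra: algebra homomorphisms from complete families of
orthogonal idempotents with compatible values of the arrows. -/
theorem exists_algHom {e : V → T} {t : ∀ {i j : V}, (i ⟶ j) → T} (h : IsQuiverFamily e t)
    (h1 : ∑ᶠ i, e i = 1) : ∃ φ : PathAlgebra K V →ₐ[K] T,
      ∀ (i j : V) (p : Quiver.Path i j), φ (ofPath K p) = evalPath e t p := by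
  let L : PathAlgebra K V →ₗ[K] T := Finsupp.linearCombination K fun p => evalPath e t p.2.2
  have hL : ∀ (i j : V) (p : Quiver.Path i j), L (ofPath K p) = evalPath e t p :=
    fun i j p => linearCombination_ofPath _ p
  have := Fintype.ofFinite V
  refine ⟨AlgHom.ofLinearMap L ?_ (map_mul_of_paths L ?_ ?_), hL⟩
  · rw [one_eq_sum, map_sum, ← h1, finsum_eq_sum_of_fintype]
    exact Finset.sum_congr rfl fun i _ => hL i i _
  · intro i j k p q
    rw [hL, hL, hL, h.evalPath_comp]
  · intro i j j' k p q hj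
    rw [hL, hL, h.evalPath_mul_of_ne _ _ hj]

/-- The map of path algebras given by a map of quivers which is injective on vertices, as a
non-unital homomorphism. -/
def mapHom {W : Type*} [Quiver W] [Finite W] (F : V ⥤q W) (hF : Function.Injective F.obj) :
    PathAlgebra K V →ₙₐ[K] PathAlgebra K W where
  toFun := pathAlgebraMap K F
  map_smul' c x := map_smul (pathAlgebraMap K F) c x
  map_zero' := map_zero (pathAlgebraMap K F)
  map_add' := map_add (pathAlgebraMap K F)
  map_mul' := pathAlgebraMap_mul F hF

theorem mapHom_ofPath {W : Type*} [Quiver W] [Finite W] (F : V ⥤q W)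
    (hF : Function.Injective F.obj) {i j : V} (p : Quiver.Path i j) :
    mapHom F hF (ofPath K p) = ofPath K (F.mapPath p) := pathAlgebraMap_ofPath F p

open Classical in
variable (K) in
/-- The augmentation of the path algebra at a vertex `b`: it sends the trivial path at `b` to `1`
and all other paths to `0`. -/
theorem exists_augmentation (b : V) : ∃ φ : PathAlgebra K V →ₐ[K] K,
    φ (vertexIdem K b) = 1 ∧ ∀ x ∈ arrowIdeal K V, φ x = 0 := by
  obtain ⟨φ, hφ⟩ := exists_algHom (K := K) (V := V) (T := K)
    (e := fun i => if i = b then 1 else 0) (t := fun _ => 0)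
    ⟨fun i => by simp, fun i j hij => by
      by_cases hi : i = b
      · subst hi; simp [hij.symm]
      · simp [hi], fun _ => by simp, fun _ => by simp⟩
    (by rw [finsum_eq_single _ b (fun i hi => if_neg hi), if_pos rfl])
  refine ⟨φ, by rw [vertexIdem, hφ, evalPath, if_pos rfl], fun x hx => ?_⟩
  have hle : arrowIdeal K V ≤ TwoSidedIdeal.ker φ := by
    rw [arrowIdeal, TwoSidedIdeal.span_le]
    rintro _ ⟨i, j, α, rfl⟩
    rw [SetLike.mem_coe, TwoSidedIdeal.mem_ker, hφ, Quiver.Hom.toPath, evalPath, zero_mul]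
  exact (TwoSidedIdeal.mem_ker φ).1 (hle hx)

end PathAlgebra

/-! ### The gluing of bound quiver algebras -/

namespace GlueVertex

variable {V : Type u} {W : Type u'} (a : V) (b : W)

theorem inl_injective : Function.Injective (inl a b) := fun i j h =>
  congrArg (Quot.lift (Sum.elim id fun _ => a) (by rintro _ _ ⟨⟩; rfl) : GlueVertex a b → V) h

theorem inr_injective : Function.Injective (inr a b) := fun i j h =>
  congrArg (Quot.lift (Sum.elim (fun _ => b) id) (by rintro _ _ ⟨⟩; rfl) : GlueVertex a b → W) h

theorem inl_eq_inr : inl a b a = inr a b b := Quot.sound .glue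

variable {a b}

theorem eq_of_inl_eq_inr {i : V} {j : W} (h : inl a b i = inr a b j) : i = a ∧ j = b :=
  ⟨congrArg (Quot.lift (Sum.elim id fun _ => a) (by rintro _ _ ⟨⟩; rfl) : GlueVertex a b → V) h,
    (congrArg (Quot.lift (Sum.elim (fun _ => b) id) (by rintro _ _ ⟨⟩; rfl) :
      GlueVertex a b → W) h).symm⟩

theorem cases {P : GlueVertex a b → Prop} (hl : ∀ i, P (inl a b i)) (hr : ∀ j, P (inr a b j))
    (x : GlueVertex a b) : P x :=
  Quot.ind (Sum.rec hl hr) x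

end GlueVertex

/-- Every arrow of the glued quiver comes from one of the two quivers. -/
theorem glueArrow_cases {V : Type u} [Quiver.{v} V] {W : Type u'} [Quiver.{v'} W] {a : V} {b : W}
    {P : ∀ x y : GlueVertex a b, (x ⟶ y) → Prop}
    (hl : ∀ (i j : V) (α : i ⟶ j), P _ _ ((glueInl a b).map α))
    (hr : ∀ (i j : W) (β : i ⟶ j), P _ _ ((glueInr a b).map β)) (x y : GlueVertex a b)
    (α : x ⟶ y) : P x y α := by
  change GlueHom a b x y at α
  cases α with
  | inl α => exact hl _ _ α
  | inr β => exact hr _ _ β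

open PathAlgebra

variable {K : Type w} [Field K] {V : Type u} [Quiver.{v} V] [Finite V] {W : Type u'}
  [Quiver.{v'} W] [Finite W] (a : V) (b : W)

variable (K) in
/-- The inclusion of the first path algebra into the path algebra of the glued quiver. -/
def glueMapA : PathAlgebra K V →ₙₐ[K] PathAlgebra K (GlueVertex a b) :=
  mapHom (glueInl a b) (GlueVertex.inl_injective a b)

variable (K) in
/-- The inclusion of the second path algebra into the path algebra of the glued quiver. -/
def glueMapB : PathAlgebra K W →ₙₐ[K] PathAlgebra K (GlueVertex a b) :=
  mapHom (glueInr a b) (GlueVertex.inr_injective a b)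

theorem glueMapA_vertexIdem (i : V) :
    glueMapA K a b (vertexIdem K i) = vertexIdem K (GlueVertex.inl a b i) := mapHom_ofPath _ _ _

theorem glueMapB_vertexIdem (j : W) :
    glueMapB K a b (vertexIdem K j) = vertexIdem K (GlueVertex.inr a b j) := mapHom_ofPath _ _ _

theorem glueMapA_toPath {i j : V} (α : i ⟶ j) :
    glueMapA K a b (ofPath K α.toPath) = ofPath K ((glueInl a b).map α).toPath :=
  mapHom_ofPath _ _ _

theorem glueMapB_toPath {i j : W} (β : i ⟶ j) :
    glueMapB K a b (ofPath K β.toPath) = ofPath K ((glueInr a b).map β).toPath :=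
  mapHom_ofPath _ _ _

theorem vertexIdem_inl_mul_inr (i : V) (j : W) (h : ¬ (i = a ∧ j = b)) :
    vertexIdem K (GlueVertex.inl a b i) * vertexIdem K (GlueVertex.inr a b j) = 0 :=
  vertexIdem_mul_of_ne fun h' => h (GlueVertex.eq_of_inl_eq_inr h')

theorem vertexIdem_inr_mul_inl (i : V) (j : W) (h : ¬ (i = a ∧ j = b)) :
    vertexIdem K (GlueVertex.inr a b j) * vertexIdem K (GlueVertex.inl a b i) = 0 :=
  vertexIdem_mul_of_ne fun h' => h (GlueVertex.eq_of_inl_eq_inr h'.symm)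

/-- The pair of inclusions into the path algebra of the glued quiver. -/
theorem gluingPair_glueMap :
    GluingPair (vertexIdem K a) (vertexIdem K b) (glueMapA K a b) (glueMapB K a b) := by
  have := Fintype.ofFinite V
  have := Fintype.ofFinite W
  have := Fintype.ofFinite (GlueVertex a b)
  have hA : glueMapA K a b 1 = ∑ i, vertexIdem K (GlueVertex.inl a b i) := by
    rw [one_eq_sum, map_sum]
    exact Finset.sum_congr rfl fun i _ => glueMapA_vertexIdem a b i
  have hB : glueMapB K a b 1 = ∑ j, vertexIdem K (GlueVertex.inr a b j) := by
    rw [one_eq_sum, map_sum]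
    exact Finset.sum_congr rfl fun i _ => glueMapB_vertexIdem a b i
  have hv : vertexIdem K (GlueVertex.inl a b a) = vertexIdem K (GlueVertex.inr a b b) := by
    rw [GlueVertex.inl_eq_inr]
  have hAl : ∀ i, glueMapA K a b 1 * vertexIdem K (GlueVertex.inl a b i) =
      vertexIdem K (GlueVertex.inl a b i) := fun i => by
    rw [← glueMapA_vertexIdem, ← map_mul, one_mul]
  have hBr : ∀ j, glueMapB K a b 1 * vertexIdem K (GlueVertex.inr a b j) =
      vertexIdem K (GlueVertex.inr a b j) := fun i => by
    rw [← glueMapB_vertexIdem, ← map_mul, one_mul]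
  have hAr : ∀ j, j ≠ b → glueMapA K a b 1 * vertexIdem K (GlueVertex.inr a b j) = 0 := by
    intro j hj
    rw [hA, Finset.sum_mul]
    exact Finset.sum_eq_zero fun i _ => vertexIdem_inl_mul_inr a b i j fun h => hj h.2
  have hBl : ∀ i, i ≠ a → glueMapB K a b 1 * vertexIdem K (GlueVertex.inl a b i) = 0 := by
    intro i hi
    rw [hB, Finset.sum_mul]
    exact Finset.sum_eq_zero fun j _ => vertexIdem_inr_mul_inl a b i j fun h => hi h.1
  have key : ∀ x : GlueVertex a b,
      (glueMapA K a b 1 + glueMapB K a b 1 - vertexIdem K (GlueVertex.inl a b a)) *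
        vertexIdem K x = vertexIdem K x := by
    intro x
    rw [sub_mul, add_mul]
    induction x using GlueVertex.cases with
    | hl i =>
      by_cases hi : i = a
      · subst hi
        rw [hAl, vertexIdem_mul_self, hv, hBr, add_sub_cancel_right]
      · rw [hAl, hBl i hi, vertexIdem_mul_of_ne
          fun h => hi (GlueVertex.inl_injective a b h).symm, add_zero, sub_zero]
    | hr j =>
      by_cases hj : j = b
      · subst hj
        rw [hBr, hv, vertexIdem_mul_self, ← hv, hAl, add_sub_cancel_right]
      · rw [hBr, hAr j hj, hv, vertexIdem_mul_of_ne
          fun h => hj (GlueVertex.inr_injective a b h).symm, zero_add, sub_zero]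
  refine ⟨?_, ?_, ?_, ?_⟩
  · rw [glueMapA_vertexIdem, glueMapB_vertexIdem, hv]
  · rw [hB, Finset.mul_sum, Finset.sum_eq_single b (fun j _ hj => hAr j hj) (by simp), ← hv, hAl,
      glueMapA_vertexIdem]
  · rw [hA, Finset.mul_sum, Finset.sum_eq_single a (fun i _ hi => hBl i hi) (by simp), hv, hBr, ← hv,
      glueMapA_vertexIdem]
  · rw [glueMapA_vertexIdem, ← sub_eq_iff_eq_add]
    have h := Finset.sum_congr rfl fun (x : GlueVertex a b) (_ : x ∈ Finset.univ) => key x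
    rwa [← Finset.mul_sum, ← one_eq_sum, mul_one] at h

/-- The universal property of the path algebra of the glued quiver. -/
theorem exists_glue_algHom {T : Type t} [Ring T] [Algebra K T] (f : PathAlgebra K V →ₙₐ[K] T)
    (g : PathAlgebra K W →ₙₐ[K] T) (h : GluingPair (vertexIdem K a) (vertexIdem K b) f g) :
    ∃ φ : PathAlgebra K (GlueVertex a b) →ₐ[K] T,
      (∀ x, φ (glueMapA K a b x) = f x) ∧ ∀ y, φ (glueMapB K a b y) = g y := by
  let e : GlueVertex a b → T := Quot.lift
    (Sum.elim (fun i => f (vertexIdem K i)) fun j => g (vertexIdem K j)) (by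
      rintro _ _ ⟨⟩
      exact h.map_eq)
  have hel : ∀ i, e (GlueVertex.inl a b i) = f (vertexIdem K i) := fun _ => rfl
  have her : ∀ j, e (GlueVertex.inr a b j) = g (vertexIdem K j) := fun _ => rfl
  let t' : ∀ x y : GlueVertex a b, GlueHom a b x y → T := fun x y α =>
    match x, y, α with
    | _, _, .inl α => f (ofPath K α.toPath)
    | _, _, .inr β => g (ofPath K β.toPath)
  let t : ∀ {x y : GlueVertex a b}, (x ⟶ y) → T := fun {x y} α => t' x y α
  have htl : ∀ {i j : V} (α : i ⟶ j),
      t ((glueInl a b).map α) = f (ofPath K α.toPath) :=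
    fun _ => rfl
  have htr : ∀ {i j : W} (β : i ⟶ j),
      t ((glueInr a b).map β) = g (ofPath K β.toPath) :=
    fun _ => rfl
  have hf1 : ∀ x, f x * f 1 = f x := fun x => by rw [← map_mul, mul_one]
  have hf1' : ∀ x, f 1 * f x = f x := fun x => by rw [← map_mul, one_mul]
  have hg1 : ∀ y, g y * g 1 = g y := fun x => by rw [← map_mul, mul_one]
  have hg1' : ∀ y, g 1 * g y = g y := fun x => by rw [← map_mul, one_mul]
  -- The images of two vertices from different quivers are orthogonal unless both are glued.
  have hfg : ∀ i j, ¬ (i = a ∧ j = b) → f (vertexIdem K i) * g (vertexIdem K j) = 0 := by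
    intro i j hij
    rw [← hf1, ← hg1', mul_assoc, ← mul_assoc (f 1), h.mul_eq]
    by_cases hi : i = a
    · rw [h.map_eq, ← map_mul g, vertexIdem_mul_of_ne fun hj => hij ⟨hi, hj.symm⟩, map_zero,
        mul_zero]
    · rw [← mul_assoc, ← map_mul f, vertexIdem_mul_of_ne hi, map_zero, zero_mul]
  have hgf : ∀ i j, ¬ (i = a ∧ j = b) → g (vertexIdem K j) * f (vertexIdem K i) = 0 := by
    intro i j hij
    rw [← hg1, ← hf1', mul_assoc, ← mul_assoc (g 1), h.mul_eq']
    by_cases hi : i = a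
    · rw [h.map_eq, ← mul_assoc, ← map_mul g, vertexIdem_mul_of_ne fun hj => hij ⟨hi, hj⟩,
        map_zero, zero_mul]
    · rw [← map_mul f, vertexIdem_mul_of_ne (Ne.symm hi), map_zero, mul_zero]
  have hfam : IsQuiverFamily e t := by
    refine ⟨fun x => ?_, fun x y hxy => ?_, fun {x y} α => ?_, fun {x y} α => ?_⟩
    · induction x using GlueVertex.cases with
      | hl i => rw [hel, ← map_mul, vertexIdem_mul_self]
      | hr j => rw [her, ← map_mul, vertexIdem_mul_self]
    · induction x using GlueVertex.cases with
      | hl i =>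
        induction y using GlueVertex.cases with
        | hl i' =>
          rw [hel, hel, ← map_mul, vertexIdem_mul_of_ne fun hi => hxy (by rw [hi]), map_zero]
        | hr j =>
          rw [hel, her, hfg _ _ fun hij => hxy (by rw [hij.1, hij.2, GlueVertex.inl_eq_inr])]
      | hr j =>
        induction y using GlueVertex.cases with
        | hl i =>
          rw [hel, her, hgf _ _ fun hij => hxy (by rw [hij.1, hij.2, GlueVertex.inl_eq_inr])]
        | hr j' =>
          rw [her, her, ← map_mul, vertexIdem_mul_of_ne fun hi => hxy (by rw [hi]), map_zero]
    · refine glueArrow_cases (P := fun x y α => e y * t α = t α) (fun i j α => ?_)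
        (fun i j β => ?_) x y α
      · rw [htl, glueInl, hel, ← map_mul, vertexIdem_mul_toPath]
      · rw [htr, glueInr, her, ← map_mul, vertexIdem_mul_toPath]
    · refine glueArrow_cases (P := fun x y α => t α * e x = t α) (fun i j α => ?_)
        (fun i j β => ?_) x y α
      · rw [htl, glueInl, hel, ← map_mul, toPath_mul_vertexIdem]
      · rw [htr, glueInr, her, ← map_mul, toPath_mul_vertexIdem]
  have := Fintype.ofFinite V
  have := Fintype.ofFinite W
  have := Fintype.ofFinite (GlueVertex a b)
  have hsum : ∑ᶠ x, e x = 1 := by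
    rw [finsum_eq_sum_of_fintype]
    have he : ∀ x, (∑ y, e y) * e x = e x := fun x => by
      rw [Finset.sum_mul, Finset.sum_eq_single x (fun y _ hy => hfam.mul_of_ne y x hy) (by simp),
        hfam.mul_self]
    have hf : (∑ y, e y) * f 1 = f 1 := by
      rw [one_eq_sum, map_sum, Finset.mul_sum]
      exact Finset.sum_congr rfl fun i _ => he (GlueVertex.inl a b i)
    have hg : (∑ y, e y) * g 1 = g 1 := by
      rw [one_eq_sum, map_sum, Finset.mul_sum]
      exact Finset.sum_congr rfl fun j _ => he (GlueVertex.inr a b j)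
    have h1 : (1 : T) = f 1 + g 1 - e (GlueVertex.inl a b a) := by
      rw [h.add_eq, hel, add_sub_cancel_right]
    calc (∑ y, e y) = (∑ y, e y) * (f 1 + g 1 - e (GlueVertex.inl a b a)) := by
          rw [← h1, mul_one]
      _ = 1 := by rw [mul_sub, mul_add, hf, hg, he, ← h1]
  obtain ⟨φ, hφ⟩ := exists_algHom (K := K) hfam hsum
  have hφv : ∀ x, φ (vertexIdem K x) = e x := fun x => hφ x x .nil
  have hφt : ∀ {x y : GlueVertex a b} (α : x ⟶ y), φ (ofPath K α.toPath) = t α :=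
    fun α => by
      rw [hφ, Quiver.Hom.toPath, evalPath, evalPath]
      exact hfam.mul_right α
  refine ⟨φ, fun x => ?_, fun y => ?_⟩
  · induction x using PathAlgebra.induction with
    | zero => simp only [map_zero]
    | add x y hx hy => simp only [map_add, hx, hy]
    | smul c i j p =>
      rw [map_smul, map_smul, map_smul]
      congr 1
      induction p with
      | nil => exact (congrArg φ (glueMapA_vertexIdem a b i)).trans (hφv _)
      | cons p α ih => rw [ofPath_cons, map_mul, map_mul, map_mul, ih, glueMapA_toPath, hφt, htl]
  · induction y using PathAlgebra.induction with
    | zero => simp only [map_zero]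
    | add x y hx hy => simp only [map_add, hx, hy]
    | smul c i j p =>
      rw [map_smul, map_smul, map_smul]
      congr 1
      induction p with
      | nil => exact (congrArg φ (glueMapB_vertexIdem a b i)).trans (hφv _)
      | cons p α ih => rw [ofPath_cons, map_mul, map_mul, map_mul, ih, glueMapB_toPath, hφt, htr]

/-- The path algebra of the glued quiver is generated by the images of the two path algebras. -/
theorem adjoin_glueMap :
    Algebra.adjoin K (Set.range (glueMapA K a b) ∪ Set.range (glueMapB K a b)) = ⊤ := by
  rw [eq_top_iff]
  intro x hx
  clear hx
  have hA : ∀ y, glueMapA K a b y ∈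
      Algebra.adjoin K (Set.range (glueMapA K a b) ∪ Set.range (glueMapB K a b)) :=
    fun y => Algebra.subset_adjoin (Or.inl ⟨y, rfl⟩)
  have hB : ∀ y, glueMapB K a b y ∈
      Algebra.adjoin K (Set.range (glueMapA K a b) ∪ Set.range (glueMapB K a b)) :=
    fun y => Algebra.subset_adjoin (Or.inr ⟨y, rfl⟩)
  induction x using PathAlgebra.induction with
  | zero => exact zero_mem _
  | add x y hx hy => exact add_mem hx hy
  | smul c i j p =>
    refine Subalgebra.smul_mem _ ?_ c
    induction p with
    | nil =>
      change vertexIdem K i ∈ _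
      induction i using GlueVertex.cases with
      | hl i =>
        rw [← glueMapA_vertexIdem]
        exact hA _
      | hr j =>
        rw [← glueMapB_vertexIdem]
        exact hB _
    | cons p α ih =>
      rw [ofPath_cons]
      refine mul_mem ?_ ih
      refine glueArrow_cases (P := fun x y α => ofPath K α.toPath ∈ Algebra.adjoin K
        (Set.range (glueMapA K a b) ∪ Set.range (glueMapB K a b))) (fun i j α => ?_)
        (fun i j β => ?_) _ _ α
      · rw [← glueMapA_toPath]
        exact hA _
      · rw [← glueMapB_toPath]
        exact hB _

variable {a b} {I_A : TwoSidedIdeal (PathAlgebra K V)} {I_B : TwoSidedIdeal (PathAlgebra K W)}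

theorem IsAdmissible.le_arrowIdeal {I : TwoSidedIdeal (PathAlgebra K V)} (hI : IsAdmissible I) :
    I ≤ arrowIdeal K V := by
  obtain ⟨m, _, _, h⟩ := hI
  intro x hx
  exact TwoSidedIdeal.mem_asIdeal.1
    (Ideal.pow_le_self two_ne_zero (h (TwoSidedIdeal.mem_asIdeal.2 hx)))

variable (a b I_A I_B)

/-- The quotient map from the path algebra to a bound quiver algebra. -/
abbrev toQuiverAlgebra {U : Type*} [Quiver U] [Finite U] (I : TwoSidedIdeal (PathAlgebra K U)) :
    PathAlgebra K U →ₐ[K] QuiverAlgebra I :=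
  Ideal.Quotient.mkₐ K I.asIdeal

theorem toQuiverAlgebra_surjective {U : Type*} [Quiver U] [Finite U]
    (I : TwoSidedIdeal (PathAlgebra K U)) : Function.Surjective (toQuiverAlgebra I) :=
  Ideal.Quotient.mk_surjective

/-- The homomorphism from the first bound quiver algebra to the simple gluing algebra. -/
def quiverAlgebraMapA : QuiverAlgebra I_A →ₙₐ[K] QuiverAlgebra (glueIdeal a b I_A I_B) :=
  nonUnitalQuotientLift I_A.asIdeal
    ((toQuiverAlgebra (glueIdeal a b I_A I_B) : PathAlgebra K (GlueVertex a b) →ₙₐ[K] _).comp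
      (glueMapA K a b)) fun x hx => by
    change Ideal.Quotient.mk _ (glueMapA K a b x) = 0
    rw [Ideal.Quotient.eq_zero_iff_mem, TwoSidedIdeal.mem_asIdeal]
    exact TwoSidedIdeal.subset_span (Or.inl ⟨x, TwoSidedIdeal.mem_asIdeal.1 hx, rfl⟩)

/-- The homomorphism from the second bound quiver algebra to the simple gluing algebra. -/
def quiverAlgebraMapB : QuiverAlgebra I_B →ₙₐ[K] QuiverAlgebra (glueIdeal a b I_A I_B) :=
  nonUnitalQuotientLift I_B.asIdeal
    ((toQuiverAlgebra (glueIdeal a b I_A I_B) : PathAlgebra K (GlueVertex a b) →ₙₐ[K] _).comp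
      (glueMapB K a b)) fun x hx => by
    change Ideal.Quotient.mk _ (glueMapB K a b x) = 0
    rw [Ideal.Quotient.eq_zero_iff_mem, TwoSidedIdeal.mem_asIdeal]
    exact TwoSidedIdeal.subset_span (Or.inr ⟨x, TwoSidedIdeal.mem_asIdeal.1 hx, rfl⟩)

/-- The universal property of the simple gluing algebra. -/
theorem exists_glueIdeal_algHom {T : Type t} [Ring T] [Algebra K T]
    (f : QuiverAlgebra I_A →ₙₐ[K] T) (g : QuiverAlgebra I_B →ₙₐ[K] T)
    (h : GluingPair (toQuiverAlgebra I_A (vertexIdem K a)) (toQuiverAlgebra I_B (vertexIdem K b))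
      f g) : ∃ φ : QuiverAlgebra (glueIdeal a b I_A I_B) →ₐ[K] T,
      (∀ x, φ (quiverAlgebraMapA a b I_A I_B x) = f x) ∧
        ∀ y, φ (quiverAlgebraMapB a b I_A I_B y) = g y := by
  obtain ⟨φ, hA, hB⟩ := exists_glue_algHom a b
    (f.comp (toQuiverAlgebra I_A : PathAlgebra K V →ₙₐ[K] QuiverAlgebra I_A))
    (g.comp (toQuiverAlgebra I_B : PathAlgebra K W →ₙₐ[K] QuiverAlgebra I_B))
    ⟨h.map_eq, h.mul_eq, h.mul_eq', h.add_eq⟩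
  have hker : glueIdeal a b I_A I_B ≤ TwoSidedIdeal.ker φ := by
    rw [glueIdeal, TwoSidedIdeal.span_le]
    rintro _ (⟨x, hx, rfl⟩ | ⟨y, hy, rfl⟩)
    · rw [SetLike.mem_coe, TwoSidedIdeal.mem_ker]
      refine (hA x).trans ((congrArg f ?_).trans (map_zero f))
      exact Ideal.Quotient.eq_zero_iff_mem.2 (TwoSidedIdeal.mem_asIdeal.2 hx)
    · rw [SetLike.mem_coe, TwoSidedIdeal.mem_ker]
      refine (hB y).trans ((congrArg g ?_).trans (map_zero g))
      exact Ideal.Quotient.eq_zero_iff_mem.2 (TwoSidedIdeal.mem_asIdeal.2 hy)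
  refine ⟨Ideal.Quotient.liftₐ _ φ fun x hx => (TwoSidedIdeal.mem_ker φ).1
    (hker (TwoSidedIdeal.mem_asIdeal.1 hx)), fun x => ?_, fun y => ?_⟩
  · obtain ⟨x, rfl⟩ := toQuiverAlgebra_surjective I_A x
    exact hA x
  · obtain ⟨y, rfl⟩ := toQuiverAlgebra_surjective I_B y
    exact hB y

theorem gluingPair_quiverAlgebraMap :
    GluingPair (toQuiverAlgebra I_A (vertexIdem K a)) (toQuiverAlgebra I_B (vertexIdem K b))
      (quiverAlgebraMapA a b I_A I_B) (quiverAlgebraMapB a b I_A I_B) where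
  map_eq := congrArg (toQuiverAlgebra _) (gluingPair_glueMap a b).map_eq
  mul_eq := congrArg (toQuiverAlgebra _) (gluingPair_glueMap a b).mul_eq
  mul_eq' := congrArg (toQuiverAlgebra _) (gluingPair_glueMap a b).mul_eq'
  add_eq := congrArg (toQuiverAlgebra _) (gluingPair_glueMap a b).add_eq

/-- A bound quiver algebra whose relations lie in the arrow ideal has an augmentation at every
vertex. -/
theorem exists_quiverAlgebra_augmentation {I : TwoSidedIdeal (PathAlgebra K V)}
    (hI : I ≤ arrowIdeal K V) (i : V) :
    ∃ ε : QuiverAlgebra I →ₐ[K] K, ε (toQuiverAlgebra I (vertexIdem K i)) = 1 := by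
  obtain ⟨φ, h, hφ⟩ := exists_augmentation K i
  exact ⟨Ideal.Quotient.liftₐ _ φ fun x hx => hφ x (hI (TwoSidedIdeal.mem_asIdeal.1 hx)), h⟩

/-- The map `y ↦ ε(y) e` for an augmentation `ε` and an idempotent `e`. -/
def augmentationSMul {R T : Type*} [Ring R] [Algebra K R] [Ring T] [Algebra K T] (ε : R →ₐ[K] K)
    (e : T) (he : e * e = e) : R →ₙₐ[K] T where
  toFun y := ε y • e
  map_smul' c y := by simp [mul_smul]
  map_zero' := by simp
  map_add' x y := by simp [add_smul]
  map_mul' x y := by simp [mul_smul, he, smul_comm (ε x)]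

theorem augmentationSMul_apply {R T : Type*} [Ring R] [Algebra K R] [Ring T] [Algebra K T]
    (ε : R →ₐ[K] K) (e : T) (he : e * e = e) (y : R) : augmentationSMul ε e he y = ε y • e := rfl

theorem toQuiverAlgebra_vertexIdem_mul_self (I : TwoSidedIdeal (PathAlgebra K V)) (i : V) :
    toQuiverAlgebra I (vertexIdem K i) * toQuiverAlgebra I (vertexIdem K i) =
      toQuiverAlgebra I (vertexIdem K i) := by
  rw [← map_mul, vertexIdem_mul_self]

/-- The identity of `A` and an augmentation of `B` at the glued vertex, with values in `A`. -/
theorem gluingPair_augmentation {A B : Type*} [Ring A] [Algebra K A] [Ring B] [Algebra K B] {a : A}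
    {b : B} (ha : a * a = a) (ε : B →ₐ[K] K) (hε : ε b = 1) :
    GluingPair a b (NonUnitalAlgHom.id K A) (augmentationSMul ε a ha) where
  map_eq := by rw [augmentationSMul_apply, hε, one_smul]; rfl
  mul_eq := by
    rw [augmentationSMul_apply, map_one ε, one_smul]
    exact one_mul a
  mul_eq' := by
    rw [augmentationSMul_apply, map_one ε, one_smul]
    exact mul_one a
  add_eq := by rw [augmentationSMul_apply, map_one ε, one_smul]; rfl

/-- The simple gluing algebra is a gluing of the two bound quiver algebras. -/
theorem exists_gluing (hA : IsAdmissible I_A) (hB : IsAdmissible I_B) :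
    Nonempty (Gluing K (QuiverAlgebra I_A) (QuiverAlgebra I_B)
      (QuiverAlgebra (glueIdeal a b I_A I_B))) := by
  obtain ⟨εA, hεA⟩ := exists_quiverAlgebra_augmentation hA.le_arrowIdeal a
  obtain ⟨εB, hεB⟩ := exists_quiverAlgebra_augmentation hB.le_arrowIdeal b
  obtain ⟨rA, hrA, -⟩ := exists_glueIdeal_algHom a b I_A I_B _ _
    (gluingPair_augmentation (toQuiverAlgebra_vertexIdem_mul_self I_A a) εB hεB)
  obtain ⟨rB, -, hrB⟩ := exists_glueIdeal_algHom a b I_A I_B _ _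
    (gluingPair_augmentation (toQuiverAlgebra_vertexIdem_mul_self I_B b) εA hεA).symm
  refine ⟨{ a := toQuiverAlgebra I_A (vertexIdem K a), b := toQuiverAlgebra I_B (vertexIdem K b),
            inA := quiverAlgebraMapA a b I_A I_B, inB := quiverAlgebraMapB a b I_A I_B,
            retrA := rA, retrB := rB, pair := gluingPair_quiverAlgebraMap a b I_A I_B,
            retrA_inA := hrA, retrB_inB := hrB, adjoin_eq_top := ?_,
            lift := fun T _ _ f g h => exists_glueIdeal_algHom a b I_A I_B f g h }⟩
  rw [← AlgHom.range_eq_top _ |>.2 (toQuiverAlgebra_surjective (glueIdeal a b I_A I_B)),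
    ← Algebra.map_top, ← adjoin_glueMap, AlgHom.map_adjoin, Set.image_union, ← Set.range_comp,
    ← Set.range_comp]
  congr 2
  · exact ((toQuiverAlgebra_surjective I_A).range_comp (quiverAlgebraMapA a b I_A I_B)).symm
  · exact ((toQuiverAlgebra_surjective I_B).range_comp (quiverAlgebraMapB a b I_A I_B)).symm

end

end SimpleGluing

theorem proposition3p4 {K : Type*} [Field K] [IsAlgClosed K]
    {V_A : Type*} [Quiver V_A] [Finite V_A] [∀ i j : V_A, Finite (i ⟶ j)]
    {V_B : Type*} [Quiver V_B] [Finite V_B] [∀ i j : V_B, Finite (i ⟶ j)]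
    (I_A : TwoSidedIdeal (SimpleGluing.PathAlgebra K V_A)) (hI_A : SimpleGluing.IsAdmissible I_A)
    (I_B : TwoSidedIdeal (SimpleGluing.PathAlgebra K V_B)) (hI_B : SimpleGluing.IsAdmissible I_B)
    (a : V_A) (b : V_B)
    (hfin : Module.Finite K
      (SimpleGluing.QuiverAlgebra (SimpleGluing.glueIdeal a b I_A I_B))) :
    (SimpleGluing.IsGorenstein (SimpleGluing.QuiverAlgebra (SimpleGluing.glueIdeal a b I_A I_B)) ↔
      SimpleGluing.IsGorenstein (SimpleGluing.QuiverAlgebra I_A) ∧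
        SimpleGluing.IsGorenstein (SimpleGluing.QuiverAlgebra I_B)) ∧
    (SimpleGluing.IsGorenstein (SimpleGluing.QuiverAlgebra (SimpleGluing.glueIdeal a b I_A I_B)) →
      max (SimpleGluing.gorensteinDim (SimpleGluing.QuiverAlgebra I_A))
          (SimpleGluing.gorensteinDim (SimpleGluing.QuiverAlgebra I_B)) ≤
        SimpleGluing.gorensteinDim
          (SimpleGluing.QuiverAlgebra (SimpleGluing.glueIdeal a b I_A I_B)) ∧
      SimpleGluing.gorensteinDim
          (SimpleGluing.QuiverAlgebra (SimpleGluing.glueIdeal a b I_A I_B)) ≤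
        max (max (SimpleGluing.gorensteinDim (SimpleGluing.QuiverAlgebra I_A))
          (SimpleGluing.gorensteinDim (SimpleGluing.QuiverAlgebra I_B))) 1) := by
  obtain ⟨g⟩ := SimpleGluing.exists_gluing a b I_A I_B hI_A hI_B
  have h := g.gorenstein
  exact ⟨h.1, fun _ => h.2⟩
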